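/- Let $n\ge 1$ and let $x_1,y_1,\dots,x_n,y_n$ be the coordinates on $(\mathbb C^2)^n$. Let $I=\bigcap_{1\le i<j\le n}(x_i-x_j,\,y_i-y_j)\subset\mathbb C[x_1,y_1,\dots,x_n,y_n]$, and for $d\ge 0$ let $I_{<d}$ be the ideal generated by the homogeneous elements of $I$ of (total) degree less than $d$. Let $D=\{(\alpha_1,\beta_1),\dots,(\alpha_n,\beta_n)\}$ be a set of $n$ distinct points of $\mathbb N\times\mathbb N$, enumerated so that the numbers $s_j:=\alpha_j+\beta_j$ satisfy $s_1\le\dots\le s_n$. Its bidegree is $(\sum_j\alpha_j,\sum_j\beta_j)$, its degree is $d=\sum_j s_j$, and $\Delta(D):=\det\big(x_i^{\alpha_j}y_i^{\beta_j}\big)_{1\le i,j\le n}$. A *staircase form* of $D$ is an $n\times n$ matrix $S$ (or its determinant $\det S$) whose $(i,j)$ entry is $0$ if $i\le s_j$, and is $a_{i1}a_{i2}\cdots a_{i,s_j}$ otherwise, where each factor $a_{i\ell}$ is either $x_i-x_\ell$ or $y_i-y_\ell$ (the choice may vary from entry to entry), and which satisfies $\det S-\Delta(D)\in I_{<d}$.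 The bidegree of the staircase form is that of $D$. Let $S$ be a nonzero staircase form of $D$ (that is, $\det S\ne0$), let $\{j: s_j=j-1\}=\{r_1<\dots<r_\ell\}$ and $r_{\ell+1}=n+1$. For $1\le t\le \ell$, the $t$-th block of $S$ is its square submatrix with row and column indices $r_t,\dots,r_{t+1}-1$. For a partition $\mu$ of a nonnegative integer $k$, we say that $S$ is of *partition type* $\mu$ if for each positive integer $m$ the number of blocks with exactly $m$ nonzero entries above the diagonal is the multiplicity of $m$ as a part of $\mu$. It is a *minimal* staircase form of partition type $\mu$ if moreover $S_{ij}=0$ whenever $j>i+1$. For two partitions $\nu,\mu$ of $k$, write $\nu\le_P\mu$ if the parts of $\nu$ can be distributed into groups whose sums are the parts of $\mu$. **Proposition.** Let $k\ge0$, $n\ge 8k+5$ and $d_1,d_2\ge(2k+1)n$ be integers, let $d=d_1+d_2$, and let $\mu$ be a partition of $k$. Then every nonzero staircase form $f$ of partition type $\mu$ and bidegree $(d_1,d_2)$ lies in the ideal $$I_{<d}+\big(\det S' \;:\; S' \text{ a minimal staircase form of bidegree }(d_1,d_2)\text{ and of some partition type }\nu\le_P\mu\big).$$ -/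

import Mathlib

open MvPolynomial

noncomputable section

namespace DiagonalIdeal

/-- The coordinate ring `ℂ[x₁, y₁, …, xₙ, yₙ]` of `(ℂ²)ⁿ`. -/
abbrev CoordRing (n : ℕ) : Type := MvPolynomial (Fin n ⊕ Fin n) ℂ

/-- The coordinate `x_i`. -/
def x {n : ℕ} (i : Fin n) : CoordRing n := X (Sum.inl i)

/-- The coordinate `y_i`. -/
def y {n : ℕ} (i : Fin n) : CoordRing n := X (Sum.inr i)

/-- The diagonal ideal `I = ⋂_{i < j} (x_i - x_j, y_i - y_j)`. -/
def diagIdeal (n : ℕ) : Ideal (CoordRing n) :=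
  ⨅ (i : Fin n) (j : Fin n) (_ : i < j), Ideal.span {x i - x j, y i - y j}

/-- The ideal `I_{<d}` generated by the elements of `I` that are homogeneous (for the total degree)
of degree less than `d`. -/
def diagIdealLT (n d : ℕ) : Ideal (CoordRing n) :=
  Ideal.span {f | f ∈ diagIdeal n ∧ ∃ e < d, f.IsHomogeneous e}

/-- The degree `|P| = α + β` of a point `P = (α, β)`. -/
def ptDeg (P : ℕ × ℕ) : ℕ := P.1 + P.2

/-- The bidegree `(∑ α_j, ∑ β_j)` of `D = {(α_1, β_1), …, (α_n, β_n)}`. -/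
def bidegree {n : ℕ} (D : Fin n → ℕ × ℕ) : ℕ × ℕ := (∑ j, (D j).1, ∑ j, (D j).2)

/-- The degree `∑ (α_j + β_j)` of `D`. -/
def degree {n : ℕ} (D : Fin n → ℕ × ℕ) : ℕ := ∑ j, ptDeg (D j)

/-- The matrix with `(i, j)` entry `x_i ^ α_j * y_i ^ β_j`; its determinant is `Δ(D)`. -/
def deltaMatrix {n : ℕ} (D : Fin n → ℕ × ℕ) : Matrix (Fin n) (Fin n) (CoordRing n) :=
  Matrix.of fun i j => x i ^ (D j).1 * y i ^ (D j).2

/-- The alternating polynomial `Δ(D)`. -/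
def Delta {n : ℕ} (D : Fin n → ℕ × ℕ) : CoordRing n := (deltaMatrix D).det

/-- Either `x_i - x_l` (for `true`) or `y_i - y_l` (for `false`). -/
def diff {n : ℕ} (b : Bool) (i l : Fin n) : CoordRing n :=
  if b then x i - x l else y i - y l

/-- `S` is a staircase form of the `n`-element set `D ⊆ ℕ × ℕ`. The set is given by an enumeration
`D 0, …, D (n-1)` with weakly increasing degrees `s_j = |D j|`. Rows and columns are numbered from
`0`, so the `(i, j)` entry of `S` vanishes for `i < s_j`, and otherwise it is
`∏_{l < s_j} a_{il}`, each `a_{il}` being `x_i - x_l` or `y_i - y_l`; the choice `c i j l` is free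
in every factor of every entry. Moreover `det S` is equivalent to `Δ(D)` modulo `I_{<d}`,
with `d` the degree of `D`. -/
structure IsStaircaseForm {n : ℕ} (D : Fin n → ℕ × ℕ)
    (S : Matrix (Fin n) (Fin n) (CoordRing n)) : Prop where
  injective : Function.Injective D
  monotone : Monotone fun j => ptDeg (D j)
  entries : ∃ c : Fin n → Fin n → Fin n → Bool, ∀ i j : Fin n,
    S i j = if (i : ℕ) < ptDeg (D j) then 0
      else ∏ l ∈ Finset.univ.filter (fun l : Fin n => (l : ℕ) < ptDeg (D j)), diff (c i j l) i l
  det_equiv : S.det - Delta D ∈ diagIdealLT n (degree D)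

/-- The indices at which the diagonal blocks begin: those `r` (numbered from `0`) with
`s_r = r`. -/
def blockStarts {n : ℕ} (D : Fin n → ℕ × ℕ) : Finset (Fin n) :=
  {r : Fin n | ptDeg (D r) = (r : ℕ)}

/-- The (consecutive) row and column indices of the diagonal block beginning at `r`: from `r` up to,
and not including, the beginning of the next block, or up to the end if there is none. -/
def block {n : ℕ} (D : Fin n → ℕ × ℕ) (r : Fin n) : Finset (Fin n) :=
  {i : Fin n | r ≤ i ∧ ∀ r' ∈ blockStarts D, r < r' → i < r'}

open Classical in
/-- The number of nonzero entries above the diagonal in the diagonal block of `S` beginning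
at `r`. -/
def aboveDiagCount {n : ℕ} (D : Fin n → ℕ × ℕ) (S : Matrix (Fin n) (Fin n) (CoordRing n))
    (r : Fin n) : ℕ :=
  ((block D r ×ˢ block D r).filter fun p => p.1 < p.2 ∧ S p.1 p.2 ≠ 0).card

/-- `S` is a nonzero staircase form of `D` of partition type `μ`: for every positive `m`, the
multiplicity of `m` as a part of `μ` is the number of diagonal blocks of `S` with exactly `m`
nonzero entries above the diagonal. -/
structure HasPartitionType {n k : ℕ} (D : Fin n → ℕ × ℕ)
    (S : Matrix (Fin n) (Fin n) (CoordRing n)) (μ : k.Partition) : Prop where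
  isStaircaseForm : IsStaircaseForm D S
  det_ne_zero : S.det ≠ 0
  count_parts : ∀ m : ℕ, 0 < m →
    μ.parts.count m = ((blockStarts D).filter fun r => aboveDiagCount D S r = m).card

/-- All entries of `S` more than one step above the diagonal vanish. -/
def VanishesFarAbove {n : ℕ} (S : Matrix (Fin n) (Fin n) (CoordRing n)) : Prop :=
  ∀ i j : Fin n, (i : ℕ) + 1 < (j : ℕ) → S i j = 0

/-- `S` is a minimal staircase form of `D` of partition type `μ`. -/
structure IsMinimalOfType {n k : ℕ} (D : Fin n → ℕ × ℕ)
    (S : Matrix (Fin n) (Fin n) (CoordRing n)) (μ : k.Partition) : Prop where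
  hasPartitionType : HasPartitionType D S μ
  vanishesFarAbove : VanishesFarAbove S

/-- `μ` is a subpartition (refinement) of `ν`: the parts of `μ` can be distributed into groups whose
sums are the parts of `ν`. (No group is empty, since the parts of `ν` are positive.) -/
def IsSubpartition {k : ℕ} (μ ν : k.Partition) : Prop :=
  ∃ G : Multiset (Multiset ℕ), G.join = μ.parts ∧ G.map Multiset.sum = ν.parts

/-- The strict order `μ <_P ν`. -/
def PartitionLT {k : ℕ} (μ ν : k.Partition) : Prop := μ ≠ ν ∧ IsSubpartition μ ν

/-- The order `μ ≤_P ν`. -/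
def PartitionLE {k : ℕ} (μ ν : k.Partition) : Prop := μ = ν ∨ PartitionLT μ ν

/-- The determinants of the minimal staircase forms of bidegree `(d₁, d₂)` and of partition
type `≤_P μ`, in `n` pairs of variables. -/
def minimalForms (n d₁ d₂ : ℕ) {k : ℕ} (μ : k.Partition) : Set (CoordRing n) :=
  {g | ∃ (D : Fin n → ℕ × ℕ) (S : Matrix (Fin n) (Fin n) (CoordRing n)) (ν : k.Partition),
    bidegree D = (d₁, d₂) ∧ IsMinimalOfType D S ν ∧ PartitionLE ν μ ∧ g = S.det}

end DiagonalIdeal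

end

/-!
Write `s_j` for the degrees of the points of `D`. Modulo `I_{<d}` a staircase form is `Δ(D)`, and
conversely every `Δ(D)` is congruent to the determinant of a staircase form with uniformly coloured
columns (`det_diffMatrix_sub_Delta_mem`). So everything can be phrased with the polynomials `Δ(D)`
and the *profile* `e` of `D`, where `D` has `m + 1 + e m` points of degree at most `m`. If there are
too few points of some degree, `Δ(D)` vanishes modulo `I_{<d}` (`Delta_mem_of_levelCount_le`). The
diagonal blocks correspond to the maximal runs of positive values of `e`, the parts of the partition
type are the sums over these runs, and a form is minimal exactly if `e ≤ 1`.

The relations come from multiplying a determinant of degree `d - 1` by a linear form. If `D` has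
exactly `c` points of degree less than `c`, then multiplication by
`∑_{i < c} x_i - ∑_{s_j < c} x_{s_j}` adds `(1, 0)` to each of these `c` points in turn, so the
corresponding sum of polynomials `Δ` lies in `I_{<d}` (`sum_Delta_raise_mem`); likewise with `y`.
Subtracting two such relations gives relations that only involve the points of a union of blocks.

With these relations a run followed by two zeros of `e` can be rewritten by profiles in which it is
longer by one place on the right, one unit having been moved there from another place of the run
(`ContainsProfile.of_right`). A run preceded by two zeros can be extended to the left in the same way
(`ContainsProfile.of_left`): the relations then allow a point just before the run to be exchanged
with points of its first level, and the resulting symmetry contradicts the antisymmetry of `Δ` unless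
the class is zero. A move keeps the run's sum or splits the run, so it refines the partition type
(`Refines.moveUnit`), and it creates no new value larger than one. As `n` is large compared with `k`,
there is room to move to the right as long as some value larger than one is at a place near the
beginning, and afterwards to the left until no such value remains. Both processes end, since
`∑ i * e i` grows in the first and falls in the second.
-/

namespace DiagonalIdeal

variable {n : ℕ}

/-! ### The polynomials `Δ(D)` -/

theorem Delta_mem_diagIdeal (D : Fin n → ℕ × ℕ) : Delta D ∈ diagIdeal n := by
  simp only [diagIdeal, Submodule.mem_iInf]
  intro i j hij
  rw [← Ideal.Quotient.eq_zero_iff_mem, Delta, RingHom.map_det]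
  have hx : Ideal.Quotient.mk (Ideal.span {x i - x j, y i - y j}) (x i) =
      Ideal.Quotient.mk _ (x j) := Ideal.Quotient.eq.2 (Ideal.subset_span (by simp))
  have hy : Ideal.Quotient.mk (Ideal.span {x i - x j, y i - y j}) (y i) =
      Ideal.Quotient.mk _ (y j) := Ideal.Quotient.eq.2 (Ideal.subset_span (by simp))
  apply Matrix.det_zero_of_row_eq hij.ne
  ext l
  simp [deltaMatrix, hx, hy]

theorem Delta_isHomogeneous (D : Fin n → ℕ × ℕ) : (Delta D).IsHomogeneous (degree D) := by
  rw [Delta, Matrix.det_apply]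
  refine IsHomogeneous.sum _ _ _ fun σ _ => ?_
  have h : (∏ j, deltaMatrix D (σ j) j).IsHomogeneous (degree D) := by
    refine IsHomogeneous.prod _ _ _ fun j _ => ?_
    simpa [deltaMatrix, ptDeg, x, y] using
      (isHomogeneous_X_pow (R := ℂ) (Sum.inl (σ j) : Fin n ⊕ Fin n) (D j).1).mul
        (isHomogeneous_X_pow (Sum.inr (σ j)) (D j).2)
  rcases Int.units_eq_one_or (Equiv.Perm.sign σ) with hs | hs
  · rw [hs, one_smul]; exact h
  · rw [hs, Units.neg_smul, one_smul]; exact h.neg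

theorem Delta_mem_diagIdealLT (D : Fin n → ℕ × ℕ) {d : ℕ} (hd : degree D < d) :
    Delta D ∈ diagIdealLT n d :=
  Ideal.subset_span ⟨Delta_mem_diagIdeal D, degree D, hd, Delta_isHomogeneous D⟩

theorem diagIdealLT_mono {d d' : ℕ} (h : d ≤ d') : diagIdealLT n d ≤ diagIdealLT n d' :=
  Ideal.span_mono fun _ ⟨hf, e, he, hfe⟩ => ⟨hf, e, he.trans_le h, hfe⟩

theorem Delta_comp_perm (D : Fin n → ℕ × ℕ) (σ : Equiv.Perm (Fin n)) :
    Delta (D ∘ σ) = (Equiv.Perm.sign σ : ℤ) * Delta D :=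
  Matrix.det_permute' σ (deltaMatrix D)

theorem Delta_eq_zero_of_eq (D : Fin n → ℕ × ℕ) {i j : Fin n} (hij : i ≠ j) (h : D i = D j) :
    Delta D = 0 :=
  Matrix.det_zero_of_column_eq hij fun l => by simp [deltaMatrix, h]

/-! ### Matrices of products of differences -/

/-- The coordinate `x_i` (for `true`) or `y_i` (for `false`). -/
noncomputable def coord (b : Bool) (i : Fin n) : CoordRing n := if b then x i else y i

theorem diff_eq (b : Bool) (i l : Fin n) : diff b i l = coord b i - coord b l := by
  cases b <;> simp [diff, coord]

theorem diff_self (b : Bool) (i : Fin n) : diff b i i = 0 := by simp [diff_eq]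

theorem diff_ne_zero (b : Bool) {i l : Fin n} (h : i ≠ l) : diff b i l ≠ 0 := by
  cases b <;> simp [diff, x, y, sub_eq_zero, X_inj, h]

/-- The number of elements of `A` coloured `true`, and the number of those coloured `false`: the
exponents of the leading monomial of `∏ l ∈ A, diff (b l) i l` in `x_i` and `y_i`. -/
def colorCount (A : Finset (Fin n)) (b : Fin n → Bool) : ℕ × ℕ :=
  ((A.filter fun l => b l = true).card, (A.filter fun l => ¬ b l = true).card)

theorem ptDeg_colorCount (A : Finset (Fin n)) (b : Fin n → Bool) :
    ptDeg (colorCount A b) = A.card :=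
  Finset.card_filter_add_card_filter_not _

theorem prod_coord (A : Finset (Fin n)) (b : Fin n → Bool) (i : Fin n) :
    ∏ l ∈ A, coord (b l) i = x i ^ (colorCount A b).1 * y i ^ (colorCount A b).2 := by
  simp only [coord, Finset.prod_ite, Finset.prod_const, colorCount]

/-- The matrix whose `(i, j)` entry is the product over `l ∈ A j` of `x_i - x_l` or `y_i - y_l`. -/
noncomputable def diffMatrix (A : Fin n → Finset (Fin n)) (b : Fin n → Fin n → Bool) :
    Matrix (Fin n) (Fin n) (CoordRing n) :=
  Matrix.of fun i j => ∏ l ∈ A j, diff (b j l) i l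

/-- Expanding every column of the matrix into monomials in `x_i, y_i` gives the leading term `Δ`
and multiples of polynomials `Δ` of smaller degree. -/
theorem det_diffMatrix_sub_Delta_mem (A : Fin n → Finset (Fin n)) (b : Fin n → Fin n → Bool) :
    (diffMatrix A b).det - Delta (fun j => colorCount (A j) (b j)) ∈
      diagIdealLT n (∑ j, (A j).card) := by
  have key : (diffMatrix A b).det = ∑ p ∈ Fintype.piFinset fun j => (A j).powerset,
      (∏ j, ∏ l ∈ A j \ p j, -coord (b j l) l) *
        Delta (fun j => colorCount (p j) (b j)) := by
    simp only [Delta, Matrix.det_apply', Finset.mul_sum]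
    rw [Finset.sum_comm]
    refine Finset.sum_congr rfl fun σ _ => ?_
    simp only [diffMatrix, deltaMatrix, Matrix.of_apply, diff_eq, sub_eq_add_neg,
      Finset.prod_add, ← prod_coord]
    rw [Finset.prod_univ_sum, Finset.mul_sum]
    refine Finset.sum_congr rfl fun p _ => ?_
    rw [Finset.prod_mul_distrib]
    ring
  have hA : A ∈ Fintype.piFinset fun j => (A j).powerset := by simp
  rw [key, ← Finset.add_sum_erase _ _ hA]
  simp only [sdiff_self, Finset.bot_eq_empty, Finset.prod_empty, Finset.prod_const_one, one_mul,
    add_sub_cancel_left]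
  refine Ideal.sum_mem _ fun p hp => Ideal.mul_mem_left _ _ (Delta_mem_diagIdealLT _ ?_)
  obtain ⟨hne, hp⟩ := Finset.mem_erase.1 hp
  have hsub : ∀ j, p j ⊆ A j := fun j => Finset.mem_powerset.1 (Fintype.mem_piFinset.1 hp j)
  obtain ⟨j, hj⟩ := Function.ne_iff.1 hne
  simp only [degree, ptDeg_colorCount]
  exact Finset.sum_lt_sum (fun i _ => Finset.card_le_card (hsub i))
    ⟨j, Finset.mem_univ _, Finset.card_lt_card ((hsub j).ssubset_of_ne hj)⟩

/-- The indices below `m`. -/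
def below (n m : ℕ) : Finset (Fin n) := Finset.univ.filter fun l => (l : ℕ) < m

theorem mem_below {m : ℕ} {l : Fin n} : l ∈ below n m ↔ (l : ℕ) < m := by simp [below]

theorem card_below {m : ℕ} (hm : m ≤ n) : (below n m).card = m := by
  simp [below, Fin.card_filter_val_lt, hm]

/-- The unit vector `(1, 0)` (for `true`) or `(0, 1)` (for `false`). -/
def unitPt (ε : Bool) : ℕ × ℕ := if ε then (1, 0) else (0, 1)

theorem ptDeg_add_unitPt (P : ℕ × ℕ) (ε : Bool) : ptDeg (P + unitPt ε) = ptDeg P + 1 := by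
  cases ε <;> simp [ptDeg, unitPt] <;> omega

/-- The colouring of the indices, for `P = (α, β)`, with `α` times the colour `true`, then `β` times
`false`, and `ε` from there on. So the same colouring serves `P` and `P + unitPt ε`. -/
def coloring (n : ℕ) (P : ℕ × ℕ) (ε : Bool) (l : Fin n) : Bool :=
  if (l : ℕ) < P.1 then true else if (l : ℕ) < ptDeg P then false else ε

theorem colorCount_coloring {P : ℕ × ℕ} (hP : ptDeg P ≤ n) (ε : Bool) :
    colorCount (below n (ptDeg P)) (coloring n P ε) = P := by
  have h1 : (colorCount (below n (ptDeg P)) (coloring n P ε)).1 = P.1 := by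
    have : (below n (ptDeg P)).filter (fun l => coloring n P ε l = true) = below n P.1 := by
      ext l
      rw [Finset.mem_filter, mem_below, mem_below, coloring, ptDeg]
      split_ifs <;> simp_all <;> omega
    rw [colorCount, this, card_below (by unfold ptDeg at hP; omega)]
  have h2 := ptDeg_colorCount (below n (ptDeg P)) (coloring n P ε)
  rw [card_below hP] at h2
  have h3 : ptDeg P = P.1 + P.2 := rfl
  have h4 : ptDeg (colorCount (below n (ptDeg P)) (coloring n P ε)) =
    (colorCount (below n (ptDeg P)) (coloring n P ε)).1 +
    (colorCount (below n (ptDeg P)) (coloring n P ε)).2 := rfl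
  exact Prod.ext h1 (by omega)

theorem below_succ (s : Fin n) : below n (s + 1) = insert s (below n s) := by
  ext l
  rw [Finset.mem_insert, mem_below, mem_below, Fin.ext_iff]
  omega

theorem notMem_below_self (s : Fin n) : s ∉ below n s := by simp [below]

theorem coloring_self {P : ℕ × ℕ} {s : Fin n} (hs : (s : ℕ) = ptDeg P) (ε : Bool) :
    coloring n P ε s = ε := by
  have : ¬ (s : ℕ) < P.1 := by unfold ptDeg at hs; omega
  simp [coloring, hs, hs ▸ this]

theorem colorCount_coloring_succ {P : ℕ × ℕ} (hP : ptDeg P < n) (ε : Bool) :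
    colorCount (below n (ptDeg P + 1)) (coloring n P ε) = P + unitPt ε := by
  have h := colorCount_coloring hP.le ε
  have hs := coloring_self (P := P) (s := ⟨ptDeg P, hP⟩) rfl ε
  have hb := below_succ (⟨ptDeg P, hP⟩ : Fin n)
  have hb' := notMem_below_self (⟨ptDeg P, hP⟩ : Fin n)
  have h1 := congrArg Prod.fst h
  have h2 := congrArg Prod.snd h
  simp only [colorCount] at h1 h2
  rw [hb, colorCount, Finset.filter_insert, Finset.filter_insert, hs]
  cases ε
  · simp [unitPt, Finset.card_insert_of_notMem, hb', h1, Prod.ext_iff]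
    simpa using h2
  · simp [unitPt, Finset.card_insert_of_notMem, hb', h1, Prod.ext_iff]
    simpa using h2

/-! ### Levels -/

/-- The number of points of `D` of degree at most `m`. -/
def levelCount (D : Fin n → ℕ × ℕ) (m : ℕ) : ℕ :=
  (Finset.univ.filter fun j => ptDeg (D j) ≤ m).card

theorem det_eq_zero_of_levelCount_le {D : Fin n → ℕ × ℕ}
    {S : Matrix (Fin n) (Fin n) (CoordRing n)}
    (hS : ∀ i j : Fin n, (i : ℕ) < ptDeg (D j) → S i j = 0) {m : ℕ} (hm : m < n)
    (h : levelCount D m ≤ m) : S.det = 0 := by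
  rw [Matrix.det_apply']
  refine Finset.sum_eq_zero fun σ _ => mul_eq_zero_of_right _ ?_
  by_contra hne
  have hle : ∀ j, ptDeg (D j) ≤ σ j := fun j => by
    by_contra hlt
    exact hne (Finset.prod_eq_zero (Finset.mem_univ j) (hS _ _ (not_le.1 hlt)))
  have hsub : (below n (m + 1)).map σ.symm.toEmbedding ⊆
      Finset.univ.filter fun j => ptDeg (D j) ≤ m := by
    intro j hj
    obtain ⟨i, hi, rfl⟩ := Finset.mem_map.1 hj
    have := hle (σ.symm i)
    simp only [Equiv.apply_symm_apply] at this
    rw [mem_below] at hi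
    simp only [Equiv.coe_toEmbedding, Finset.mem_filter, Finset.mem_univ, true_and]
    omega
  have hc := Finset.card_le_card hsub
  rw [Finset.card_map, card_below (by omega)] at hc
  unfold levelCount at h
  omega

/-- The matrix of products of differences with uniformly coloured columns attached to `D`. -/
noncomputable def stairMatrix (D : Fin n → ℕ × ℕ) (ε : Bool) :
    Matrix (Fin n) (Fin n) (CoordRing n) :=
  diffMatrix (fun j => below n (ptDeg (D j))) fun j => coloring n (D j) ε

theorem diffMatrix_apply_eq_zero {A : Fin n → Finset (Fin n)} (b : Fin n → Fin n → Bool)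
    {i j : Fin n} (h : i ∈ A j) : diffMatrix A b i j = 0 :=
  Finset.prod_eq_zero h (diff_self _ _)

theorem stairMatrix_det_sub_Delta_mem {D : Fin n → ℕ × ℕ} (hD : ∀ j, ptDeg (D j) ≤ n) (ε : Bool) :
    (stairMatrix D ε).det - Delta D ∈ diagIdealLT n (degree D) := by
  have h := det_diffMatrix_sub_Delta_mem (fun j => below n (ptDeg (D j)))
    fun j => coloring n (D j) ε
  simp only [fun j => colorCount_coloring (hD j) ε, fun j => card_below (hD j)] at h
  exact h

/-- The staircase relation: `Δ(D)` vanishes modulo `I_{<d}` when `D` has too few points of low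
degree, since a matrix congruent to it then has a too large block of zeros. -/
theorem Delta_mem_of_levelCount_le {D : Fin n → ℕ × ℕ} (hD : ∀ j, ptDeg (D j) ≤ n) {m : ℕ}
    (hm : m < n) (h : levelCount D m ≤ m) : Delta D ∈ diagIdealLT n (degree D) := by
  have h1 := stairMatrix_det_sub_Delta_mem hD true
  have h0 : (stairMatrix D true).det = 0 := det_eq_zero_of_levelCount_le
    (fun _ _ hij => diffMatrix_apply_eq_zero _ (mem_below.2 hij)) hm h
  rw [h0, zero_sub, neg_mem_iff] at h1
  exact h1

/-! ### Raising points -/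

/-- The tuple obtained from `D` by adding a unit vector to its `j`-th point. -/
def raise (D : Fin n → ℕ × ℕ) (ε : Bool) (j : Fin n) : Fin n → ℕ × ℕ :=
  Function.update D j (D j + unitPt ε)

theorem ptDeg_raise (D : Fin n → ℕ × ℕ) (ε : Bool) (j i : Fin n) :
    ptDeg (raise D ε j i) = ptDeg (D i) + if i = j then 1 else 0 := by
  by_cases h : i = j
  · subst h; simp [raise, ptDeg_add_unitPt]
  · simp [raise, h]

theorem degree_raise (D : Fin n → ℕ × ℕ) (ε : Bool) (j : Fin n) :
    degree (raise D ε j) = degree D + 1 := by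
  simp [degree, ptDeg_raise, Finset.sum_add_distrib]

theorem bidegree_eq_sum (D : Fin n → ℕ × ℕ) : bidegree D = ∑ i, D i :=
  Prod.ext (by simp [bidegree, Prod.fst_sum]) (by simp [bidegree, Prod.snd_sum])

theorem bidegree_raise (D : Fin n → ℕ × ℕ) (ε : Bool) (j : Fin n) :
    bidegree (raise D ε j) = bidegree D + unitPt ε := by
  have h : ∀ i, raise D ε j i = D i + if i = j then unitPt ε else 0 := fun i => by
    by_cases h : i = j
    · subst h; simp [raise]
    · simp [raise, h]
  simp [bidegree_eq_sum, h, Finset.sum_add_distrib]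

theorem levelCount_raise (D : Fin n → ℕ × ℕ) (ε : Bool) (j : Fin n) (m : ℕ) :
    levelCount (raise D ε j) m + (if m = ptDeg (D j) then 1 else 0) = levelCount D m := by
  simp only [levelCount, Finset.card_filter, ptDeg_raise]
  rw [← Finset.add_sum_erase _ _ (Finset.mem_univ j),
    ← Finset.add_sum_erase (a := j) Finset.univ (fun i => if ptDeg (D i) ≤ m then 1 else 0)
      (Finset.mem_univ j)]
  have : ∑ i ∈ Finset.univ.erase j, (if ptDeg (D i) + (if i = j then 1 else 0) ≤ m then 1 else 0) =
      ∑ i ∈ Finset.univ.erase j, if ptDeg (D i) ≤ m then 1 else 0 :=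
    Finset.sum_congr rfl fun i hi => by simp [Finset.ne_of_mem_erase hi]
  rw [this]
  split_ifs <;> simp_all <;> omega

/-- The relation obtained by multiplying the determinant congruent to `Δ(D)` by the difference of
`∑_{i < c} x_i` and `∑_{s_j < c} x_{s_j}` (or of the same with `y`): if exactly `c` columns have
degree less than `c`, then in each nonzero term of the expansion those columns are matched with the
first `c` rows, so that multiplication by this factor raises these columns one at a time. -/
theorem sum_Delta_raise_mem {D : Fin n → ℕ × ℕ} (hD : ∀ j, ptDeg (D j) < n) (ε : Bool) {c : ℕ}
    (hc : (Finset.univ.filter fun j => ptDeg (D j) < c).card = c) :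
    ∑ j with ptDeg (D j) < c, Delta (raise D ε j) ∈ diagIdealLT n (degree D + 1) := by
  classical
  set J := Finset.univ.filter fun j => ptDeg (D j) < c with hJ
  have hcn : c ≤ n := by rw [← hc]; simpa using Finset.card_le_univ J
  set s : Fin n → Fin n := fun j => ⟨ptDeg (D j), hD j⟩ with hs
  set T := stairMatrix D ε with hT
  set M : Fin n → Matrix (Fin n) (Fin n) (CoordRing n) := fun j =>
    diffMatrix (fun i => below n (ptDeg (raise D ε j i))) fun i => coloring n (D i) ε with hM
  have hTmem : T.det ∈ diagIdealLT n (degree D + 1) := by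
    have h1 := diagIdealLT_mono (Nat.le_succ _)
      (stairMatrix_det_sub_Delta_mem (fun j => (hD j).le) ε)
    simpa using Ideal.add_mem _ h1 (Delta_mem_diagIdealLT D (Nat.lt_succ_self _))
  have hMmem : ∀ j, (M j).det - Delta (raise D ε j) ∈ diagIdealLT n (degree D + 1) := by
    intro j
    have h1 := det_diffMatrix_sub_Delta_mem (fun i => below n (ptDeg (raise D ε j i)))
      fun i => coloring n (D i) ε
    have h2 : (fun i => colorCount (below n (ptDeg (raise D ε j i))) (coloring n (D i) ε)) =
        raise D ε j := by
      funext i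
      rw [ptDeg_raise]
      by_cases h : i = j
      · subst h; simp [raise, colorCount_coloring_succ (hD i)]
      · simp [raise, h, colorCount_coloring (hD i).le]
    have h3 : ∑ i, (below n (ptDeg (raise D ε j i))).card = degree D + 1 := by
      rw [← degree_raise D ε j]
      refine Finset.sum_congr rfl fun i _ => card_below ?_
      rw [ptDeg_raise]
      have := hD i
      split_ifs <;> omega
    rwa [h2, h3] at h1
  have hMapp : ∀ j i l, M j i l = T i l * if l = j then diff ε i (s j) else 1 := by
    intro j i l
    simp only [hM, hT, stairMatrix, diffMatrix, Matrix.of_apply, ptDeg_raise]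
    by_cases h : l = j
    · subst h
      have hb := below_succ (s l)
      simp only [hs] at hb
      rw [if_pos rfl, if_pos rfl, hb, Finset.prod_insert (notMem_below_self (s l)),
        coloring_self rfl, mul_comm]
    · simp [h]
  have key : ∑ j ∈ J, (M j).det =
      (∑ i ∈ below n c, coord ε i - ∑ j ∈ J, coord ε (s j)) * T.det := by
    simp only [Matrix.det_apply', Finset.mul_sum]
    rw [Finset.sum_comm]
    refine Finset.sum_congr rfl fun σ _ => ?_
    have h1 : ∀ j, ∏ l, M j (σ l) l = (∏ l, T (σ l) l) * diff ε (σ j) (s j) := by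
      intro j
      simp only [hMapp, Finset.prod_mul_distrib]
      simp
    simp only [h1, diff_eq]
    rw [← Finset.mul_sum, ← Finset.mul_sum, Finset.sum_sub_distrib]
    by_cases hz : ∏ l, T (σ l) l = 0
    · simp [hz]
    · have hle : ∀ j, ptDeg (D j) ≤ σ j := fun j => by
        by_contra hlt
        exact hz (Finset.prod_eq_zero (Finset.mem_univ j)
          (diffMatrix_apply_eq_zero _ (mem_below.2 (not_le.1 hlt))))
      have hsub : (below n c).map σ.symm.toEmbedding ⊆ J := by
        intro j hj
        obtain ⟨i, hi, rfl⟩ := Finset.mem_map.1 hj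
        have := hle (σ.symm i)
        simp only [Equiv.apply_symm_apply] at this
        rw [mem_below] at hi
        simp only [hJ, Equiv.coe_toEmbedding, Finset.mem_filter, Finset.mem_univ, true_and]
        omega
      have heq := Finset.eq_of_subset_of_card_le hsub
        (by rw [Finset.card_map, card_below hcn, hc])
      have : ∑ j ∈ J, coord ε (σ j) = ∑ i ∈ below n c, coord ε i := by
        rw [← heq, Finset.sum_map]; simp
      rw [this]
      ring
  have h1 : ∑ j ∈ J, (M j).det ∈ diagIdealLT n (degree D + 1) := by
    rw [key]; exact Ideal.mul_mem_left _ _ hTmem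
  have h2 := Ideal.sub_mem _ h1 (Ideal.sum_mem _ fun j (_ : j ∈ J) => hMmem j)
  simpa using h2

/-- The local form of the relation for the points with degrees in an interval that is a union of
diagonal blocks. -/
theorem sum_Delta_raise_Ico_mem {D : Fin n → ℕ × ℕ} (hD : ∀ j, ptDeg (D j) < n) (ε : Bool)
    {c c' : ℕ} (hcc : c ≤ c') (hc : (Finset.univ.filter fun j => ptDeg (D j) < c).card = c)
    (hc' : (Finset.univ.filter fun j => ptDeg (D j) < c').card = c') :
    ∑ j with c ≤ ptDeg (D j) ∧ ptDeg (D j) < c', Delta (raise D ε j) ∈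
      diagIdealLT n (degree D + 1) := by
  classical
  have h := Ideal.sub_mem _ (sum_Delta_raise_mem hD ε hc') (sum_Delta_raise_mem hD ε hc)
  have hsub : (Finset.univ.filter fun j => ptDeg (D j) < c) ⊆
      Finset.univ.filter fun j => ptDeg (D j) < c' := fun j hj => by
    simp only [Finset.mem_filter, Finset.mem_univ, true_and] at hj ⊢
    omega
  rw [← Finset.sum_sdiff hsub, add_sub_cancel_right] at h
  convert h using 2
  ext j
  simp only [Finset.mem_filter, Finset.mem_univ, true_and, Finset.mem_sdiff]
  omega

/-! ### Profiles and their moves -/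

/-- `D` has profile `e` if it has `m + 1 + e m` points of degree at most `m`, for each `m < n`. For
an enumeration with weakly increasing degrees, `e m` is the number of nonzero entries above the
diagonal in row `m` of a staircase form. -/
def HasProfile (D : Fin n → ℕ × ℕ) (e : ℕ → ℕ) : Prop :=
  ∀ m < n, levelCount D m = m + 1 + e m

/-- The ideal `K` contains `Δ(D)` for all `D` of bidegree `p` and of profile `e`. -/
def ContainsProfile (K : Ideal (CoordRing n)) (p : ℕ × ℕ) (e : ℕ → ℕ) : Prop :=
  ∀ D : Fin n → ℕ × ℕ, bidegree D = p → HasProfile D e → Delta D ∈ K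

/-- The profile `e` with one unit moved from the place `w` to the place `u`. -/
def moveUnit (e : ℕ → ℕ) (u w : ℕ) : ℕ → ℕ := e + Pi.single u 1 - Pi.single w 1

theorem levelCount_congr {D D' : Fin n → ℕ × ℕ} (h : ∀ j, ptDeg (D j) = ptDeg (D' j)) (m : ℕ) :
    levelCount D m = levelCount D' m := by
  simp [levelCount, h]

theorem levelCount_le (D : Fin n → ℕ × ℕ) (m : ℕ) : levelCount D m ≤ n := by
  simpa [levelCount] using Finset.card_le_univ (Finset.univ.filter fun j => ptDeg (D j) ≤ m)

theorem levelCount_succ (D : Fin n → ℕ × ℕ) (m : ℕ) :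
    levelCount D (m + 1) =
      levelCount D m + (Finset.univ.filter fun j => ptDeg (D j) = m + 1).card := by
  classical
  rw [levelCount, levelCount, ← Finset.card_union_of_disjoint]
  · congr 1
    ext j
    simp only [Finset.mem_filter, Finset.mem_univ, true_and, Finset.mem_union]
    omega
  · rw [Finset.disjoint_filter]
    intro j _ h
    omega

theorem HasProfile.ptDeg_lt {D : Fin n → ℕ × ℕ} {e : ℕ → ℕ} (h : HasProfile D e) (j : Fin n) :
    ptDeg (D j) < n := by
  have hj := j.pos
  have h1 := h (n - 1) (by omega)
  have h2 : (Finset.univ.filter fun j => ptDeg (D j) ≤ n - 1).card =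
      (Finset.univ : Finset (Fin n)).card := by
    have := levelCount_le D (n - 1)
    simp only [levelCount] at h1 this
    rw [Finset.card_univ, Fintype.card_fin]
    omega
  have h3 := (Finset.card_filter_eq_iff (s := Finset.univ)
    (p := fun j => ptDeg (D j) ≤ n - 1)).1 h2 j (Finset.mem_univ j)
  omega

theorem HasProfile.card_lt {D : Fin n → ℕ × ℕ} {e : ℕ → ℕ} (h : HasProfile D e) {c : ℕ}
    (hcn : c ≤ n) (hc : c = 0 ∨ e (c - 1) = 0) :
    (Finset.univ.filter fun j => ptDeg (D j) < c).card = c := by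
  rcases Nat.eq_zero_or_pos c with rfl | hpos
  · simp
  · have h1 := h (c - 1) (by omega)
    rw [hc.resolve_left (by omega), levelCount] at h1
    simp only [fun j => show ptDeg (D j) ≤ c - 1 ↔ ptDeg (D j) < c by omega] at h1
    omega

theorem degree_eq (D : Fin n → ℕ × ℕ) : degree D = (bidegree D).1 + (bidegree D).2 :=
  Finset.sum_add_distrib

/-- Raising the points of one level, modulo the polynomials with one point of another level in the
same union of blocks raised. -/
theorem sum_level_mem {K : Ideal (CoordRing n)} {p : ℕ × ℕ}
    (hK : diagIdealLT n (p.1 + p.2) ≤ K) {e : ℕ → ℕ} {D : Fin n → ℕ × ℕ} (hD : HasProfile D e)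
    (ε : Bool) (hp : bidegree D + unitPt ε = p) {c c' q : ℕ} (hc : c = 0 ∨ e (c - 1) = 0)
    (hc' : e (c' - 1) = 0) (hc'n : c' ≤ n) (hcq : c ≤ q) (hqc' : q < c')
    (hgood : ∀ w, c ≤ w → w < c' → w ≠ q → 0 < e w → ContainsProfile K p (e - Pi.single w 1)) :
    ∑ j with ptDeg (D j) = q, Delta (raise D ε j) ∈ K := by
  classical
  have hdeg : degree D + 1 = p.1 + p.2 := by
    rw [← degree_raise D ε (⟨0, by omega⟩ : Fin n), degree_eq, bidegree_raise, hp]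
  have h := sum_Delta_raise_Ico_mem hD.ptDeg_lt ε (hcq.trans hqc'.le)
    (hD.card_lt (by omega) hc) (hD.card_lt hc'n (.inr hc'))
  rw [hdeg] at h
  have hsub : (Finset.univ.filter fun j => ptDeg (D j) = q) ⊆
      Finset.univ.filter fun j => c ≤ ptDeg (D j) ∧ ptDeg (D j) < c' := fun j hj => by
    simp only [Finset.mem_filter, Finset.mem_univ, true_and] at hj ⊢
    omega
  rw [← Finset.sum_sdiff hsub] at h
  refine (Ideal.add_mem_iff_right K (Ideal.sum_mem _ fun j hj => ?_)).1 (hK h)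
  simp only [Finset.mem_sdiff, Finset.mem_filter, Finset.mem_univ, true_and] at hj
  obtain ⟨⟨hj1, hj2⟩, hj3⟩ := hj
  have hlc := levelCount_raise D ε j
  -- where `e` is zero, raising a point leaves too few points of low degree
  rcases Nat.eq_zero_or_pos (e (ptDeg (D j))) with h0 | hpos
  · have h1 := hlc (ptDeg (D j))
    rw [if_pos rfl, hD _ (by omega), h0] at h1
    have h2 : Delta (raise D ε j) ∈ _ :=
      Delta_mem_of_levelCount_le (m := ptDeg (D j)) (fun i => ?_) (by omega) (by omega)
    · rw [degree_raise, hdeg] at h2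
      exact hK h2
    · rw [ptDeg_raise]
      have := hD.ptDeg_lt i
      split_ifs <;> omega
  · refine hgood _ hj1 hj2 hj3 hpos _ (by rw [bidegree_raise, hp]) fun m hm => ?_
    have h1 := hlc m
    rw [hD m hm] at h1
    simp only [Pi.sub_apply, Pi.single_apply]
    split_ifs at h1 ⊢ with h2
    · rw [← h2] at hpos; omega
    · omega

theorem HasProfile.of_raise {D D' : Fin n → ℕ × ℕ} {e : ℕ → ℕ} {ε : Bool} {j : Fin n}
    (hD' : HasProfile D' e) (h : ∀ i, ptDeg (raise D ε j i) = ptDeg (D' i)) :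
    HasProfile D (e + Pi.single (ptDeg (D j)) 1) := by
  intro m hm
  rw [← levelCount_raise D ε j m, levelCount_congr h, hD' m hm, Pi.add_apply, Pi.single_apply,
    add_assoc]

theorem exists_add_unitPt {P : ℕ × ℕ} (h : 0 < ptDeg P) : ∃ Q ε, P = Q + unitPt ε := by
  obtain ⟨a, b⟩ := P
  rcases Nat.eq_zero_or_pos a with rfl | ha
  · exact ⟨(0, b - 1), false, by simp [ptDeg] at h; simp [unitPt]; omega⟩
  · exact ⟨(a - 1, b), true, by simp [unitPt]; omega⟩

/-- A run of the profile can be extended to the right, at the cost of one unit from one of its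
places. Here the point that gets lowered is the only one on its new level, so that the relation has
only one term of profile `e`. -/
theorem ContainsProfile.of_right {K : Ideal (CoordRing n)} {p : ℕ × ℕ}
    (hK : diagIdealLT n (p.1 + p.2) ≤ K) {e : ℕ → ℕ} {v u : ℕ} (hv : v = 0 ∨ e (v - 1) = 0)
    (hvu : v < u) (hun : u + 1 < n) (he : 0 < e (u - 1)) (hu : e u = 0) (hu' : e (u + 1) = 0)
    (hgood : ∀ w, v ≤ w → w < u → 0 < e w →
      ContainsProfile K p (moveUnit e u w)) : ContainsProfile K p e := by
  classical
  intro D hp hD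
  have h1 := levelCount_succ D u
  rw [hD _ (by omega), hD _ (by omega), hu, hu'] at h1
  obtain ⟨j, hj⟩ := Finset.card_pos.1 (show 0 < (Finset.univ.filter
    fun j => ptDeg (D j) = u + 1).card by omega)
  simp only [Finset.mem_filter, Finset.mem_univ, true_and] at hj
  obtain ⟨Q, ε, hQ⟩ := exists_add_unitPt (P := D j) (by omega)
  set D' := Function.update D j Q with hD'
  have hraise : raise D' ε j = D := by
    funext i
    by_cases h : i = j
    · subst h; simp [raise, hD', hQ]
    · simp [raise, hD', h]
  have hju : ptDeg (D' j) = u := by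
    have := ptDeg_add_unitPt Q ε
    rw [← hQ, hj] at this
    simp only [hD', Function.update_self]
    omega
  have hprof : HasProfile D' (e + Pi.single u 1) := by
    rw [← hju]
    exact hD.of_raise (ε := ε) fun i => by rw [hraise]
  have hlevel : (Finset.univ.filter fun i => ptDeg (D' i) = u) = {j} := by
    refine Finset.eq_singleton_iff_unique_mem.2 ⟨by simp [hju], fun i hi => ?_⟩
    have h2 := levelCount_succ D' (u - 1)
    rw [Nat.sub_add_cancel (by omega), hprof _ (by omega), hprof _ (by omega), Pi.add_apply,
      Pi.add_apply, hu, Pi.single_eq_same, Pi.single_eq_of_ne (by omega)] at h2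
    exact Finset.card_le_one.1 (by omega) i hi j (by simp [hju])
  have h3 := sum_level_mem hK hprof ε (by rw [← bidegree_raise, hraise, hp])
    (c := v) (c' := u + 2) (q := u)
    (hv.imp id fun h => by simp [h, Pi.single_apply]; omega)
    (by simp [hu']) (by omega) hvu.le (by omega) fun w hw1 hw2 hw3 hw4 => by
      rw [Pi.add_apply, Pi.single_eq_of_ne hw3] at hw4
      rcases Nat.lt_or_ge w u with h | h
      · exact hgood w hw1 h hw4
      · obtain rfl : w = u + 1 := by omega
        omega
  rwa [hlevel, Finset.sum_singleton, hraise] at h3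

/-- A function that is antisymmetric in its last two arguments, and unchanged when its first two
arguments are exchanged directly or with a shift by one, vanishes. The point is that the arguments
can be brought into a range where the exchanges generate an action of the symmetric group. -/
theorem eq_zero_of_exchange {M : Type*} [AddCommGroup M] (hM : ∀ a : M, a = -a → a = 0)
    {v A : ℕ} (hv : 2 ≤ v) (G : ℕ → ℕ → ℕ → M)
    (h0 : ∀ q r t, q < v → r < v → t ≤ v → q + r + t = A → G q r t = G r q t)
    (h1 : ∀ q r t, q < v → r < v → t ≤ v → q + r + t + 1 = A → G q (r + 1) t = G r (q + 1) t)
    (ha : ∀ q r t, G q r t = -G q t r) {q r t : ℕ} (hq : q < v) (hr : r ≤ v) (ht : t ≤ v)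
    (hA : q + r + t = A) : G q r t = 0 := by
  -- the exchange without shift acts on triples with all entries less than `v`, and the exchange
  -- with shift on those with `1 ≤ r, t`; in both cases a permutation argument gives `G = -G`
  have low : ∀ q r t, q < v → r < v → t < v → q + r + t = A → G q r t = 0 := by
    intro q r t hq hr ht hA
    apply hM
    calc G q r t = G r q t := h0 q r t hq hr ht.le hA
      _ = -G r t q := ha _ _ _
      _ = -G t r q := by rw [h0 r t q hr ht hq.le (by omega)]
      _ = G t q r := by rw [ha t r q, neg_neg]
      _ = G q t r := h0 t q r ht hq hr.le (by omega)
      _ = -G q r t := ha _ _ _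
  have high : ∀ q r t, q < v → r < v → t < v → q + r + t + 2 = A →
      G q (r + 1) (t + 1) = 0 := by
    intro q r t hq hr ht hA
    apply hM
    calc G q (r + 1) (t + 1) = G r (q + 1) (t + 1) := h1 q r (t + 1) hq hr ht (by omega)
      _ = -G r (t + 1) (q + 1) := ha _ _ _
      _ = -G t (r + 1) (q + 1) := by rw [h1 r t (q + 1) hr ht hq (by omega)]
      _ = G t (q + 1) (r + 1) := by rw [ha t (r + 1), neg_neg]
      _ = G q (t + 1) (r + 1) := h1 t q (r + 1) ht hq hr (by omega)
      _ = -G q (r + 1) (t + 1) := ha _ _ _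
  -- the remaining triples are carried into one of these ranges by one exchange
  have mixed : ∀ q, q < v → q + v = A → G q 0 v = 0 := by
    intro q hq hA
    rw [h0 q 0 v hq (by omega) le_rfl (by omega)]
    rcases Nat.eq_zero_or_pos q with rfl | hpos
    · have h2 := h1 0 (v - 1) 0 (by omega) (by omega) (by omega) (by omega)
      rw [Nat.sub_add_cancel (by omega)] at h2
      rw [ha, h2, low _ _ _ (by omega) (by omega) (by omega) (by omega), neg_zero]
    · have h2 := high 0 (q - 1) (v - 1) (by omega) (by omega) (by omega) (by omega)
      rwa [Nat.sub_add_cancel (by omega), Nat.sub_add_cancel (by omega)] at h2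
  rcases Nat.eq_zero_or_pos r with rfl | hr0
  · rcases ht.lt_or_eq with ht' | rfl
    · exact low _ _ _ hq (by omega) ht' hA
    · exact mixed q hq (by omega)
  · rcases Nat.eq_zero_or_pos t with rfl | ht0
    · rcases hr.lt_or_eq with hr' | rfl
      · exact low _ _ _ hq hr' (by omega) hA
      · rw [ha, mixed q hq (by omega), neg_zero]
    · have h2 := high q (r - 1) (t - 1) hq (by omega) (by omega) (by omega)
      rwa [Nat.sub_add_cancel hr0, Nat.sub_add_cancel ht0] at h2

/-- The tuple `D` with three of its points replaced. -/
def replace (D : Fin n → ℕ × ℕ) (j₀ j₁ j₂ : Fin n) (P₀ P₁ P₂ : ℕ × ℕ) (i : Fin n) : ℕ × ℕ :=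
  if i = j₀ then P₀ else if i = j₁ then P₁ else if i = j₂ then P₂ else D i

theorem bidegree_replace (D : Fin n → ℕ × ℕ) {j₀ j₁ j₂ : Fin n} (h₁ : j₁ ≠ j₀) (h₂ : j₂ ≠ j₀)
    (h₁₂ : j₂ ≠ j₁) {P₀ P₁ P₂ : ℕ × ℕ} (h : P₀ + P₁ + P₂ = D j₀ + D j₁ + D j₂) :
    bidegree (replace D j₀ j₁ j₂ P₀ P₁ P₂) = bidegree D := by
  classical
  have hsum : ∀ f : Fin n → ℕ × ℕ, ∑ i, f i =
      f j₀ + f j₁ + f j₂ + ∑ i ∈ ((Finset.univ.erase j₀).erase j₁).erase j₂, f i := fun f => by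
    rw [← Finset.add_sum_erase _ _ (Finset.mem_univ j₀),
      ← Finset.add_sum_erase (Finset.univ.erase j₀) f (a := j₁) (by simp [h₁]),
      ← Finset.add_sum_erase ((Finset.univ.erase j₀).erase j₁) f (a := j₂) (by simp [h₂, h₁₂]),
      ← add_assoc, ← add_assoc]
  rw [bidegree_eq_sum, bidegree_eq_sum, hsum, hsum D, ← h]
  congr 1
  · simp [replace, h₁, h₂, h₁₂]
  · refine Finset.sum_congr rfl fun i hi => ?_
    simp only [Finset.mem_erase, Finset.mem_univ, and_true] at hi
    simp [replace, hi]

theorem Delta_comp_swap (D : Fin n → ℕ × ℕ) {i j : Fin n} (h : i ≠ j) :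
    Delta (D ∘ Equiv.swap i j) = -Delta D := by
  rw [Delta_comp_perm, Equiv.Perm.sign_swap h]; simp

/-- A point on the level before a run and a point on the first level of the run can be exchanged,
up to a shift by the unit vector that the relation uses. -/
theorem exchange_mem {K : Ideal (CoordRing n)} {p : ℕ × ℕ}
    (hK : diagIdealLT n (p.1 + p.2) ≤ K) {e : ℕ → ℕ} {v u : ℕ} (hv : 1 ≤ v)
    (hvu : v + 1 < u) (hun : u < n) (hv1 : e v = 0) (hv2 : e (v - 1) = 0) (hu : e u = 0)
    (hgood : ∀ w, v + 1 ≤ w → w < u → 0 < e w →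
      ContainsProfile K p (moveUnit e v w))
    {D : Fin n → ℕ × ℕ} (hp : bidegree D = p) (hD : HasProfile D e) {j₀ j₁ j₂ : Fin n}
    (h₁ : j₁ ≠ j₀) (h₂ : j₂ ≠ j₀) (hj₁₂ : j₁ ≠ j₂) (hj₀ : ptDeg (D j₀) = v)
    (hj₁ : ptDeg (D j₁) = v + 1) (hj₂ : ptDeg (D j₂) = v + 1) (ε : Bool) {q r t : ℕ}
    (hq : q ≤ v) (hr : r ≤ v) (ht : t ≤ v + 1)
    (hsum : q + r + t + (unitPt ε).1 = (D j₀).1 + (D j₁).1 + (D j₂).1) :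
    Delta (replace D j₀ j₁ j₂ (q, v - q)
        (r + (unitPt ε).1, v + 1 - (r + (unitPt ε).1)) (t, v + 1 - t)) -
      Delta (replace D j₀ j₁ j₂ (r, v - r)
        (q + (unitPt ε).1, v + 1 - (q + (unitPt ε).1)) (t, v + 1 - t)) ∈ K := by
  classical
  have hd₀ : (D j₀).1 + (D j₀).2 = v := hj₀
  have hd₁ : (D j₁).1 + (D j₁).2 = v + 1 := hj₁
  have hd₂ : (D j₂).1 + (D j₂).2 = v + 1 := hj₂
  have hunit : ∀ s, s ≤ v → ((s, v - s) : ℕ × ℕ) + unitPt ε =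
      (s + (unitPt ε).1, v + 1 - (s + (unitPt ε).1)) := fun s hs => by
    cases ε
    · simp [unitPt]; omega
    · simp [unitPt]
  set D' := replace D j₀ j₁ j₂ (q, v - q) (r, v - r) (t, v + 1 - t) with hD'
  have e₁ : raise D' ε j₁ = replace D j₀ j₁ j₂ (q, v - q)
      (r + (unitPt ε).1, v + 1 - (r + (unitPt ε).1)) (t, v + 1 - t) := by
    funext i
    rw [← hunit r hr]
    by_cases h : i = j₁
    · subst h; simp [raise, hD', replace, h₁]
    · simp [raise, hD', replace, h]
  have e₀ : raise D' ε j₀ = replace D j₀ j₁ j₂ (r, v - r)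
      (q + (unitPt ε).1, v + 1 - (q + (unitPt ε).1)) (t, v + 1 - t) ∘ Equiv.swap j₀ j₁ := by
    funext i
    rw [← hunit q hq]
    by_cases h : i = j₀
    · subst h; simp [raise, hD', replace, h₁]
    · by_cases h' : i = j₁
      · subst h'; simp [raise, hD', replace, h]
      · simp [raise, hD', replace, h, h', Equiv.swap_apply_of_ne_of_ne]
  have hε : (unitPt ε).1 ≤ 1 := by cases ε <;> simp [unitPt]
  have hbi : bidegree D' + unitPt ε = p := by
    rw [← bidegree_raise D' ε j₁, e₁, ← hp]
    refine bidegree_replace D h₁ h₂ hj₁₂.symm (Prod.ext ?_ ?_)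
    · simp only [Prod.fst_add]; omega
    · simp only [Prod.snd_add]; omega
  have hd₁' : ptDeg (D' j₁) = v := by simp [hD', replace, h₁, ptDeg]; omega
  have hd₀' : ptDeg (D' j₀) = v := by simp [hD', replace, ptDeg]; omega
  have hprof : HasProfile D' (e + Pi.single v 1) := by
    rw [← hd₁']
    refine hD.of_raise (ε := ε) fun i => ?_
    rw [e₁]
    simp only [replace]
    split_ifs with hi₀ hi₁ hi₂
    · subst hi₀; simp only [ptDeg] at hj₀ ⊢; omega
    · subst hi₁; simp only [ptDeg] at hj₁ ⊢; omega
    · subst hi₂; simp only [ptDeg] at hj₂ ⊢; omega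
    · rfl
  have hlevel : (Finset.univ.filter fun i => ptDeg (D' i) = v) = {j₀, j₁} := by
    refine (Finset.eq_of_subset_of_card_le (fun i hi => ?_) ?_).symm
    · rcases Finset.mem_insert.1 hi with rfl | hi
      · simp [hd₀']
      · rw [Finset.mem_singleton.1 hi]; simp [hd₁']
    · have l3 := levelCount_succ D' (v - 1)
      rw [Nat.sub_add_cancel (by omega), hprof _ (by omega), hprof _ (by omega), Pi.add_apply,
        Pi.add_apply, Pi.single_eq_same, Pi.single_eq_of_ne (by omega)] at l3
      rw [Finset.card_pair h₁.symm]
      omega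
  have hmem := sum_level_mem hK hprof ε hbi (c := v) (c' := u + 1) (q := v)
    (.inr (by simp [hv2, Pi.single_apply]; omega))
    (by simp [hu, Pi.single_apply]; omega) (by omega) le_rfl (by omega)
    fun w hw1 hw2 hw3 hw4 => by
      rw [Pi.add_apply, Pi.single_eq_of_ne hw3] at hw4
      have : w ≠ u := by rintro rfl; omega
      exact hgood w (by omega) (by omega) hw4
  rw [hlevel, Finset.sum_pair h₁.symm, e₀, e₁, Delta_comp_swap _ h₁.symm, neg_add_eq_sub] at hmem
  exact hmem

/-- A run of the profile can be extended to the left, at the cost of one unit from one of its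
places. The relations express that a point on the level before the run and one of the points on its
first level can be exchanged, with and without a shift; together with the antisymmetry in the points
of the first level, this leaves nothing. -/
theorem ContainsProfile.of_left {K : Ideal (CoordRing n)} {p : ℕ × ℕ}
    (hK : diagIdealLT n (p.1 + p.2) ≤ K) {e : ℕ → ℕ} {v u : ℕ} (hv : 2 ≤ v)
    (hvu : v < u) (hun : u < n) (he : 0 < e v) (hv1 : e (v - 1) = 0) (hv2 : e (v - 2) = 0)
    (hu : e u = 0)
    (hgood : ∀ w, v ≤ w → w < u → 0 < e w →
      ContainsProfile K p (moveUnit e (v - 1) w)) : ContainsProfile K p e := by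
  classical
  intro D hp hD
  obtain ⟨v, rfl⟩ : ∃ m, v = m + 1 := ⟨v - 1, by omega⟩
  simp only [Nat.add_sub_cancel] at hv1 hgood
  rw [show v + 1 - 2 = v - 1 by omega] at hv2
  have l1 := levelCount_succ D (v - 1)
  have l2 := levelCount_succ D v
  rw [Nat.sub_add_cancel (by omega), hD _ (by omega), hD _ (by omega)] at l1
  rw [hD _ (by omega), hD _ (by omega)] at l2
  obtain ⟨j₀, hj₀⟩ := Finset.card_pos.1 (show 0 < (Finset.univ.filter
    fun j => ptDeg (D j) = v).card by omega)
  obtain ⟨j₁, hj₁, j₂, hj₂, hj₁₂⟩ := Finset.one_lt_card.1 (show 1 < (Finset.univ.filter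
    fun j => ptDeg (D j) = v + 1).card by omega)
  simp only [Finset.mem_filter, Finset.mem_univ, true_and] at hj₀ hj₁ hj₂
  have h₁ : j₁ ≠ j₀ := by rintro rfl; omega
  have h₂ : j₂ ≠ j₀ := by rintro rfl; omega
  set A := (D j₀).1 + (D j₁).1 + (D j₂).1 with hA
  have hd₀ : (D j₀).1 + (D j₀).2 = v := hj₀
  have hd₁ : (D j₁).1 + (D j₁).2 = v + 1 := hj₁
  have hd₂ : (D j₂).1 + (D j₂).2 = v + 1 := hj₂
  set G : ℕ → ℕ → ℕ → CoordRing n ⧸ K := fun q r t => Ideal.Quotient.mk K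
    (Delta (replace D j₀ j₁ j₂ (q, v - q) (r, v + 1 - r) (t, v + 1 - t))) with hG
  have hexch : ∀ ε : Bool, ∀ q r t, q < v + 1 → r < v + 1 → t ≤ v + 1 →
      q + r + t + (unitPt ε).1 = A → G q (r + (unitPt ε).1) t = G r (q + (unitPt ε).1) t :=
    fun ε q r t hq hr ht hsum => Ideal.Quotient.eq.2 <|
      exchange_mem hK (by omega) (by omega) hun hv1 hv2 hu hgood hp hD h₁ h₂ hj₁₂ hj₀ hj₁ hj₂
        ε (by omega) (by omega) ht hsum
  have hanti : ∀ q r t, G q r t = -G q t r := by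
    intro q r t
    simp only [hG]
    rw [← map_neg, ← Delta_comp_swap _ hj₁₂]
    congr 2
    funext i
    by_cases h : i = j₀
    · subst h; simp [replace, Equiv.swap_apply_of_ne_of_ne h₁.symm h₂.symm]
    · by_cases h' : i = j₁
      · subst h'; simp [replace, h₁, h₂, hj₁₂.symm]
      · by_cases h'' : i = j₂
        · subst h''; simp [replace, h₁, h₂, hj₁₂.symm]
        · simp [replace, h, h', h'', Equiv.swap_apply_of_ne_of_ne]
  have htwo : ∀ a : CoordRing n ⧸ K, a = -a → a = 0 := by
    intro a ha
    have h2 : (2 : ℂ) • a = 0 := by rw [two_smul]; nth_rewrite 1 [ha]; simp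
    simpa using h2
  have hzero : G (D j₀).1 (D j₁).1 (D j₂).1 = 0 :=
    eq_zero_of_exchange htwo hv G (by simpa [unitPt] using hexch false)
      (by simpa [unitPt, add_assoc] using hexch true) hanti
      (by omega) (by omega) (by omega) hA.symm
  have hself : replace D j₀ j₁ j₂ ((D j₀).1, v - (D j₀).1) ((D j₁).1, v + 1 - (D j₁).1)
      ((D j₂).1, v + 1 - (D j₂).1) = D := by
    funext i
    simp only [replace]
    split_ifs with hi₀ hi₁ hi₂
    · subst hi₀; exact Prod.ext rfl (by simp only; omega)
    · subst hi₁; exact Prod.ext rfl (by simp only; omega)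
    · subst hi₂; exact Prod.ext rfl (by simp only; omega)
    · rfl
  simp only [hG, hself] at hzero
  exact Ideal.Quotient.eq_zero_iff_mem.1 hzero

/-! ### Partition types of profiles -/

/-- The sum of `e` over the places below `n` that have the label `r`. -/
def labelSum (n : ℕ) (M e : ℕ → ℕ) (r : ℕ) : ℕ :=
  ∑ i ∈ Finset.range n, if M i = r then e i else 0

/-- The multiset of the positive sums of `e` over the classes of the labelling `M`. Labels are
numbers less than `n`. -/
def labelType (n : ℕ) (M e : ℕ → ℕ) : Multiset ℕ :=
  ((Finset.range n).val.map (labelSum n M e)).filter (0 < ·)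

/-- The profile `e` arises by splitting up a profile with the parts `P`: there is a labelling of the
places, constant on each run of nonzero values of `e`, whose classes have the sums `P`. -/
def Refines (n : ℕ) (e : ℕ → ℕ) (P : Multiset ℕ) : Prop :=
  ∃ M : ℕ → ℕ, (∀ i, 0 < e i → 0 < e (i + 1) → M i = M (i + 1)) ∧ (∀ i < n, M i < n) ∧
    labelType n M e = P

/-- The conditions met by the profile, extended by zero, of an injective tuple of `n` points whose
profile has sum `k`. -/
structure IsAdmissible (n k : ℕ) (e : ℕ → ℕ) : Prop where
  zero : e 0 = 0
  last : ∀ i, n ≤ i + 1 → e i = 0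
  sum : ∑ i ∈ Finset.range n, e i = k

theorem label_eq_of_run {M e : ℕ → ℕ} (hM : ∀ i, 0 < e i → 0 < e (i + 1) → M i = M (i + 1))
    {i j : ℕ} (hij : i ≤ j) (h : ∀ l, i ≤ l → l ≤ j → 0 < e l) : M i = M j := by
  induction j, hij using Nat.le_induction with
  | base => rfl
  | succ j hij ih =>
    rw [ih fun l h1 h2 => h l h1 (by omega)]
    exact hM j (h j hij (by omega)) (h _ (by omega) le_rfl)

theorem moveUnit_apply (e : ℕ → ℕ) (u w i : ℕ) :
    moveUnit e u w i = e i + (if i = u then 1 else 0) - if i = w then 1 else 0 := by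
  simp [moveUnit, Pi.single_apply]

theorem sum_moveUnit (f : ℕ → ℕ) {e : ℕ → ℕ} {u w : ℕ} (hu : u < n) (hw : w < n) (he : 0 < e w) :
    ∑ i ∈ Finset.range n, f i * moveUnit e u w i + f w =
      ∑ i ∈ Finset.range n, f i * e i + f u := by
  have h : ∀ i, f i * moveUnit e u w i + (if i = w then f i else 0) =
      f i * e i + if i = u then f i else 0 := fun i => by
    rw [moveUnit_apply]
    by_cases h1 : i = w
    · subst h1
      rw [if_pos rfl, if_pos rfl, ← Nat.mul_succ, Nat.succ_eq_add_one, Nat.sub_add_cancel (by omega)]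
      split_ifs <;> simp [Nat.mul_add]
    · rw [if_neg h1, if_neg h1]
      split_ifs <;> simp [Nat.mul_add]
  have h2 := Finset.sum_congr (rfl : Finset.range n = Finset.range n) fun i _ => h i
  simpa [Finset.sum_add_distrib, hu, hw] using h2

theorem IsAdmissible.moveUnit {k : ℕ} {e : ℕ → ℕ} (h : IsAdmissible n k e) {u w : ℕ} (hu : 0 < u)
    (hun : u + 1 < n) (he : 0 < e w) : IsAdmissible n k (moveUnit e u w) where
  zero := by rw [moveUnit_apply, h.zero, if_neg (by omega)]; simp
  last i hi := by rw [moveUnit_apply, h.last i hi, if_neg (by omega)]; simp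
  sum := by
    have hw : w < n := by
      by_contra hw
      have := h.last w (by omega)
      omega
    have h1 := sum_moveUnit (fun _ => 1) (by omega : u < n) hw he
    simp only [one_mul] at h1
    have h2 := h.sum
    omega

theorem Refines.moveUnit {e : ℕ → ℕ} {P : Multiset ℕ} {u w : ℕ} (hun : u < n) (hwn : w < n)
    (hu : e u = 0) (hw : 0 < e w) (h : Refines n e P)
    (hadj : ∀ M : ℕ → ℕ, (∀ i, 0 < e i → 0 < e (i + 1) → M i = M (i + 1)) →
      (0 < e (u + 1) → M w = M (u + 1)) ∧ (∀ i, i + 1 = u → 0 < e i → M w = M i)) :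
    Refines n (moveUnit e u w) P := by
  obtain ⟨M, hM, hMn, rfl⟩ := h
  obtain ⟨hr, hl⟩ := hadj M hM
  have hwu : w ≠ u := by rintro rfl; omega
  have hle : ∀ i, i ≠ u → 0 < DiagonalIdeal.moveUnit e u w i → 0 < e i := fun i hi h => by
    rw [moveUnit_apply, if_neg hi] at h
    omega
  refine ⟨Function.update M u (M w), fun i h1 h2 => ?_, fun i hi => ?_, ?_⟩
  · by_cases hi : i = u
    · subst hi
      rw [Function.update_self, Function.update_of_ne (by omega)]
      exact hr (hle _ (by omega) h2)
    · by_cases hi' : i + 1 = u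
      · subst hi'
        rw [Function.update_self, Function.update_of_ne (by omega)]
        exact (hl i rfl (hle _ hi h1)).symm
      · rw [Function.update_of_ne hi, Function.update_of_ne hi']
        exact hM i (hle _ hi h1) (hle _ hi' h2)
  · by_cases h : i = u
    · subst h; rw [Function.update_self]; exact hMn w hwn
    · rw [Function.update_of_ne h]; exact hMn i hi
  · have key : labelSum n (Function.update M u (M w)) (DiagonalIdeal.moveUnit e u w) =
        labelSum n M e := by
      funext r
      have h1 := sum_moveUnit (fun i => if Function.update M u (M w) i = r then 1 else 0) hun hwn hw
      simp only [Function.update_self, Function.update_of_ne hwu, ite_mul, one_mul, zero_mul,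
        add_left_inj] at h1
      rw [labelSum, h1, labelSum]
      refine Finset.sum_congr rfl fun i _ => ?_
      by_cases h : i = u
      · subst h; simp [hu]
      · rw [Function.update_of_ne h]
    rw [labelType, labelType, key]

theorem exists_consecutive_zeros {k : ℕ} {e : ℕ → ℕ} (h : ∑ i ∈ Finset.range n, e i = k) {a : ℕ}
    (ha : a + 2 * (k + 1) ≤ n) : ∃ i, a ≤ i ∧ i + 1 < a + 2 * (k + 1) ∧ e i = 0 ∧ e (i + 1) = 0 := by
  by_contra! hne
  have key : ∀ m ≤ k + 1, m ≤ ∑ i ∈ Finset.Ico a (a + 2 * m), e i := by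
    intro m
    induction m with
    | zero => simp
    | succ m ih =>
      intro hm
      rw [show a + 2 * (m + 1) = a + 2 * m + 1 + 1 by ring,
        Finset.sum_Ico_succ_top (by omega), Finset.sum_Ico_succ_top (by omega)]
      have h1 := ih (by omega)
      have h2 := hne (a + 2 * m) (by omega) (by omega)
      omega
  have h1 := key (k + 1) le_rfl
  have h2 : ∑ i ∈ Finset.Ico a (a + 2 * (k + 1)), e i ≤ ∑ i ∈ Finset.range n, e i :=
    Finset.sum_le_sum_of_subset fun i hi => by
      rw [Finset.mem_Ico] at hi
      rw [Finset.mem_range]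
      omega
  omega

/-- The last place `r ≤ i` with `r = 0` or `e (r - 1) = 0`: the first index of the diagonal block that
contains `i`. -/
def runStart (e : ℕ → ℕ) (i : ℕ) : ℕ := Nat.findGreatest (fun r => r = 0 ∨ e (r - 1) = 0) i

theorem runStart_eq_iff {e : ℕ → ℕ} {i r : ℕ} :
    runStart e i = r ↔ (r = 0 ∨ e (r - 1) = 0) ∧ r ≤ i ∧ ∀ l, r ≤ l → l < i → 0 < e l := by
  rw [runStart, Nat.findGreatest_eq_iff]
  constructor
  · rintro ⟨h1, h2, h3⟩
    refine ⟨?_, h1, fun l hl hli => ?_⟩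
    · rcases Nat.eq_zero_or_pos r with h | h
      · exact .inl h
      · exact h2 (by omega)
    · have := h3 (n := l + 1) (by omega) (by omega)
      simp only [Nat.add_sub_cancel] at this
      omega
  · rintro ⟨h1, h2, h3⟩
    refine ⟨h2, fun _ => h1, fun l hl hli h => ?_⟩
    have := h3 (l - 1) (by omega) (by omega)
    omega

/-! ### Reduction to profiles with values at most one -/

/-- Moving the units of the runs to the right, as long as there is a value larger than one at one of
the first `2 * k + 2` places. -/
theorem ContainsProfile.reduce_right {K : Ideal (CoordRing n)} {p : ℕ × ℕ}
    (hK : diagIdealLT n (p.1 + p.2) ≤ K) {k : ℕ} (hn : 4 * k + 4 ≤ n) {P : Multiset ℕ}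
    (H : ∀ e, IsAdmissible n k e → Refines n e P → (∀ i, i ≤ 2 * k + 1 → e i ≤ 1) →
      ContainsProfile K p e)
    (e : ℕ → ℕ) (he : IsAdmissible n k e) (hP : Refines n e P) : ContainsProfile K p e := by
  induction hN : n * k - ∑ i ∈ Finset.range n, i * e i using Nat.strong_induction_on
    generalizing e with
  | _ N ih =>
  by_cases hz : ∀ i, i ≤ 2 * k + 1 → e i ≤ 1
  · exact H e he hP hz
  push Not at hz
  obtain ⟨z, hz, hez⟩ := hz
  have hex : ∃ u, z < u ∧ u + 1 < n ∧ e u = 0 ∧ e (u + 1) = 0 := by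
    obtain ⟨i, h1, h2, h3⟩ := exists_consecutive_zeros he.sum (a := z + 1) (by omega)
    exact ⟨i, by omega, by omega, h3⟩
  classical
  obtain ⟨h1, h2, h3, h4⟩ := Nat.find_spec hex
  have hmin := fun m => Nat.find_min hex (m := m)
  set u := Nat.find hex
  -- by minimality of `u` there is a run that ends just before `u`
  have hpos : 0 < e (u - 1) := by
    rcases Nat.lt_or_ge z (u - 1) with h | h
    · by_contra h5
      refine hmin (u - 1) (by omega) ⟨h, by omega, by omega, ?_⟩
      rwa [Nat.sub_add_cancel (by omega)]
    · rw [show u - 1 = z by omega]; omega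
  obtain ⟨hv1, hv2, hv3⟩ := runStart_eq_iff.1 (rfl : runStart e (u - 1) = _)
  set v := runStart e (u - 1)
  refine of_right hK hv1 (by omega) h2 hpos h3 h4 fun w hw1 hw2 hw3 => ?_
  have hrun : ∀ l, v ≤ l → l < u → 0 < e l := fun l hl1 hl2 => by
    rcases Nat.lt_or_ge l (u - 1) with h | h
    · exact hv3 l hl1 h
    · rwa [show l = u - 1 by omega]
  have hadm : IsAdmissible n k (moveUnit e u w) := he.moveUnit (by omega) h2 hw3
  refine ih _ ?_ _ hadm (hP.moveUnit (by omega) (by omega) h3 hw3 fun M hM => ⟨by omega, ?_⟩) rfl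
  · have h5 := sum_moveUnit (fun i => i) (by omega : u < n) (by omega : w < n) hw3
    have h6 : ∑ i ∈ Finset.range n, i * moveUnit e u w i ≤ n * k := by
      rw [← hadm.sum, Finset.mul_sum]
      exact Finset.sum_le_sum fun i hi => Nat.mul_le_mul_right _ (Finset.mem_range.1 hi).le
    omega
  · intro i hi _
    exact label_eq_of_run hM (by omega) fun l hl1 hl2 => hrun l (by omega) (by omega)

/-- Moving the units of the runs to the left, when no value at the first `2 * k + 2` places is
larger than one. -/
theorem ContainsProfile.reduce_left {K : Ideal (CoordRing n)} {p : ℕ × ℕ}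
    (hK : diagIdealLT n (p.1 + p.2) ≤ K) {k : ℕ} (hn : 4 * k + 4 ≤ n) {P : Multiset ℕ}
    (H : ∀ e, IsAdmissible n k e → Refines n e P → (∀ i, e i ≤ 1) → ContainsProfile K p e)
    (e : ℕ → ℕ) (he : IsAdmissible n k e) (hP : Refines n e P)
    (hle : ∀ i, i ≤ 2 * k + 1 → e i ≤ 1) : ContainsProfile K p e := by
  induction hN : ∑ i ∈ Finset.range n, i * e i using Nat.strong_induction_on generalizing e with
  | _ N ih =>
  by_cases hz : ∀ i, e i ≤ 1
  · exact H e he hP hz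
  push Not at hz
  obtain ⟨z, hez⟩ := hz
  have hzk : 2 * k + 2 ≤ z := by
    by_contra h
    have := hle z (by omega)
    omega
  have hzn : z + 1 < n := by
    by_contra h
    have := he.last z (by omega)
    omega
  obtain ⟨i, -, hi, hi0, hi1⟩ := exists_consecutive_zeros he.sum (a := 0) (by omega)
  let Q : ℕ → Prop := fun m => 1 ≤ m ∧ e m = 0 ∧ e (m - 1) = 0
  have hQ : Q (Nat.findGreatest Q (z - 1)) :=
    Nat.findGreatest_spec (m := i + 1) (by omega) ⟨by omega, hi1, hi0⟩
  have hmax := fun m => Nat.findGreatest_is_greatest (P := Q) (n := z - 1) (k := m)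
  have hlez : Nat.findGreatest Q (z - 1) ≤ z - 1 := Nat.findGreatest_le _
  set m := Nat.findGreatest Q (z - 1)
  obtain ⟨h1, h2, h3⟩ := hQ
  -- by maximality of `m` there is a run that begins just after `m`
  have hpos : 0 < e (m + 1) := by
    rcases Nat.lt_or_ge (m + 1) z with h | h
    · by_contra h4
      exact hmax (m + 1) (by omega) (by omega) ⟨by omega, by omega, h2⟩
    · rw [show m + 1 = z by omega]; omega
  have hex : ∃ u, m + 1 < u ∧ e u = 0 := ⟨n - 1, by omega, he.last _ (by omega)⟩
  obtain ⟨hu1, hu2⟩ := Nat.find_spec hex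
  have hmin := fun l => Nat.find_min hex (m := l)
  have hun : Nat.find hex ≤ n - 1 := Nat.find_min' hex ⟨by omega, he.last _ (by omega)⟩
  set u := Nat.find hex
  have hrun : ∀ l, m + 1 ≤ l → l < u → 0 < e l := fun l hl1 hl2 => by
    rcases hl1.eq_or_lt with rfl | hl1
    · exact hpos
    · by_contra h
      exact hmin l hl2 ⟨hl1, by omega⟩
  refine of_left hK (v := m + 1) (by omega) hu1 (by omega) hpos h2
    (by rwa [show m + 1 - 2 = m - 1 by omega]) hu2 fun w hw1 hw2 hw3 => ?_
  rw [Nat.add_sub_cancel]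
  have hadm : IsAdmissible n k (moveUnit e m w) := he.moveUnit h1 (by omega) hw3
  refine ih _ ?_ _ hadm (hP.moveUnit (by omega) (by omega) h2 hw3 fun M hM => ⟨fun _ => ?_, ?_⟩)
    (fun i hi => ?_) rfl
  · have h5 := sum_moveUnit (fun i => i) (by omega : m < n) (by omega : w < n) hw3
    omega
  · exact (label_eq_of_run hM hw1 fun l hl1 hl2 => hrun l hl1 (by omega)).symm
  · intro i hi hpos
    rw [show i = m - 1 by omega, h3] at hpos
    omega
  · have h5 := hle i hi
    rw [moveUnit_apply]
    have h6 : i = m → e i = 0 := fun h => h ▸ h2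
    split_ifs <;> omega

/-! ### Partition types of staircase forms -/

theorem sum_filter_pos (s : Multiset ℕ) : (s.filter (0 < ·)).sum = s.sum := by
  induction s using Multiset.induction with
  | empty => simp
  | cons a s ih =>
    rcases Nat.eq_zero_or_pos a with rfl | h
    · simp [ih]
    · simp [h, ih]

theorem count_labelType (M e : ℕ → ℕ) {m : ℕ} (hm : 0 < m) :
    (labelType n M e).count m = ((Finset.range n).filter fun r => labelSum n M e r = m).card := by
  rw [labelType, Multiset.count_filter_of_pos hm, Multiset.count_map]
  simp only [eq_comm (a := m)]
  rfl

theorem sum_labelType {M e : ℕ → ℕ} (hM : ∀ i < n, M i < n) :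
    (labelType n M e).sum = ∑ i ∈ Finset.range n, e i := by
  rw [labelType, sum_filter_pos]
  change ∑ r ∈ Finset.range n, labelSum n M e r = _
  simp only [labelSum]
  rw [Finset.sum_comm]
  refine Finset.sum_congr rfl fun i hi => ?_
  simp [hM i (Finset.mem_range.1 hi)]

theorem runStart_lt {e : ℕ → ℕ} {i : ℕ} (hi : i < n) : runStart e i < n :=
  (Nat.findGreatest_le i).trans_lt hi

theorem labelSum_runStart_fiber {M e : ℕ → ℕ}
    (hM : ∀ i, 0 < e i → 0 < e (i + 1) → M i = M (i + 1)) (r : ℕ) :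
    ∑ r' ∈ Finset.range n, (if M r' = r then labelSum n (runStart e) e r' else 0) =
      labelSum n M e r := by
  have h : ∀ r', (if M r' = r then labelSum n (runStart e) e r' else 0) =
      ∑ i ∈ Finset.range n, if runStart e i = r' then (if M r' = r then e i else 0) else 0 :=
    fun r' => by
      split_ifs
      · rfl
      · simp
  rw [Finset.sum_congr rfl fun r' _ => h r', Finset.sum_comm, labelSum]
  refine Finset.sum_congr rfl fun i hi => ?_
  rw [Finset.sum_ite_eq, if_pos (Finset.mem_range.2 (runStart_lt (Finset.mem_range.1 hi)))]
  rcases Nat.eq_zero_or_pos (e i) with h0 | hpos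
  · simp [h0]
  · obtain ⟨-, h1, h2⟩ := runStart_eq_iff.1 (rfl : runStart e i = _)
    rw [label_eq_of_run hM h1 fun l hl1 hl2 => ?_]
    rcases hl2.eq_or_lt with rfl | hl2
    · exact hpos
    · exact h2 l hl1 hl2

theorem Refines.exists_groups {e : ℕ → ℕ} {P : Multiset ℕ} (h : Refines n e P) :
    ∃ G : Multiset (Multiset ℕ), G.join = labelType n (runStart e) e ∧ G.map Multiset.sum = P := by
  obtain ⟨M, hM, hMn, rfl⟩ := h
  set b := labelSum n (runStart e) e with hb
  set grp : ℕ → Multiset ℕ := fun r =>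
    (((Finset.range n).filter fun r' => M r' = r).val.map b).filter (0 < ·) with hgrp
  have hsum : ∀ r, (grp r).sum = labelSum n M e r := fun r => by
    simp only [hgrp]
    rw [sum_filter_pos, ← labelSum_runStart_fiber hM r, ← Finset.sum_filter]
    rfl
  refine ⟨((Finset.range n).filter fun r => 0 < labelSum n M e r).val.map grp, ?_, ?_⟩
  · ext m
    rcases Nat.eq_zero_or_pos m with rfl | hm
    · rw [Multiset.count_eq_zero_of_notMem, Multiset.count_eq_zero_of_notMem]
      · simp [labelType]
      · simp [hgrp]
    · have hcount : ∀ r, (grp r).count m =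
          (((Finset.range n).filter fun r' => b r' = m).filter fun r' => M r' = r).card := fun r => by
        simp only [hgrp]
        rw [Multiset.count_filter_of_pos (p := fun x => 0 < x) hm, Multiset.count_map,
          Finset.filter_comm]
        simp only [eq_comm (a := m)]
        rfl
      rw [count_labelType _ _ hm, ← hb, Finset.card_eq_sum_card_fiberwise (f := M)
        (t := Finset.range n) fun i hi => by
          simp only [Finset.coe_filter, Finset.mem_range, Set.mem_ofPred_eq] at hi
          simpa using hMn i hi.1]
      simp only [← hcount]
      change Multiset.count m (Multiset.bind _ grp) = _
      rw [Multiset.count_bind]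
      change ∑ r ∈ (Finset.range n).filter _, _ = _
      refine Finset.sum_subset (Finset.filter_subset _ _) fun r hr hr' => ?_
      have h0 : (grp r).sum = 0 := by
        rw [hsum]
        simp only [Finset.mem_filter, not_and] at hr'
        have := hr' hr
        omega
      refine Multiset.count_eq_zero_of_notMem fun hmem => ?_
      have := Multiset.le_sum_of_mem hmem
      omega
  · rw [Multiset.map_map, labelType, Finset.filter_val, Multiset.filter_map]
    exact Multiset.map_congr rfl fun r _ => hsum r

/-- In a weakly increasing enumeration the points of degree at most `m` come first. -/
theorem ptDeg_le_iff {D : Fin n → ℕ × ℕ} (hD : Monotone fun j => ptDeg (D j)) (j : Fin n) (m : ℕ) :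
    ptDeg (D j) ≤ m ↔ (j : ℕ) < levelCount D m := by
  constructor
  · intro h
    have hsub : below n (j + 1) ⊆ Finset.univ.filter fun i => ptDeg (D i) ≤ m := fun i hi => by
      rw [mem_below] at hi
      simpa using (hD (Fin.le_def.2 (by omega : (i : ℕ) ≤ j))).trans h
    have := Finset.card_le_card hsub
    rwa [card_below j.isLt] at this
  · contrapose!
    intro h
    have hsub : (Finset.univ.filter fun i => ptDeg (D i) ≤ m) ⊆ below n j := fun i hi => by
      simp only [Finset.mem_filter, Finset.mem_univ, true_and] at hi
      rw [mem_below]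
      by_contra h'
      have : ptDeg (D j) ≤ ptDeg (D i) := hD (Fin.le_def.2 (not_lt.1 h'))
      omega
    have := Finset.card_le_card hsub
    rwa [card_below j.isLt.le] at this

theorem mem_blockStarts_iff {D : Fin n → ℕ × ℕ} (hD : Monotone fun j => ptDeg (D j)) {e : ℕ → ℕ}
    (he : HasProfile D e) (r : Fin n) :
    r ∈ blockStarts D ↔ (r : ℕ) = 0 ∨ e (r - 1) = 0 := by
  have h1 := (ptDeg_le_iff hD r r).2 (by rw [he _ r.isLt]; omega)
  simp only [blockStarts, Finset.mem_filter, Finset.mem_univ, true_and]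
  rcases Nat.eq_zero_or_pos (r : ℕ) with h | h
  · simp only [h, true_or, iff_true]; omega
  · have h2 := ptDeg_le_iff hD r (r - 1)
    rw [he _ (by omega)] at h2
    omega

theorem mem_block_iff {D : Fin n → ℕ × ℕ} (hD : Monotone fun j => ptDeg (D j)) {e : ℕ → ℕ}
    (he : HasProfile D e) {r : Fin n} (hr : r ∈ blockStarts D) (i : Fin n) :
    i ∈ block D r ↔ runStart e i = r := by
  rw [runStart_eq_iff, ← mem_blockStarts_iff hD he]
  simp only [block, Finset.mem_filter, Finset.mem_univ, true_and, hr]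
  refine and_congr Fin.le_def ⟨fun h l hl hli => ?_, fun h r' hr' hrr' => ?_⟩
  · by_contra h0
    have h1 := h ⟨l + 1, by omega⟩ ((mem_blockStarts_iff hD he _).2 (.inr (by simp; omega)))
      (Fin.lt_def.2 (by simp; omega))
    have := Fin.lt_def.1 h1
    simp only at this
    omega
  · by_contra h0
    have h1 := Fin.lt_def.1 hrr'
    have h2 := Fin.le_def.1 (not_lt.1 h0)
    have h3 := h (r' - 1) (by omega) (by omega)
    have h4 := (mem_blockStarts_iff hD he r').1 hr'
    omega

/-- The nonzero entries above the diagonal in row `i` are the `e i` entries following the diagonal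
one, and they all lie in the diagonal block of that row. -/
theorem aboveDiagCount_eq {D : Fin n → ℕ × ℕ} {S : Matrix (Fin n) (Fin n) (CoordRing n)}
    (hD : Monotone fun j => ptDeg (D j)) {e : ℕ → ℕ} (he : HasProfile D e)
    (hS : ∀ i j : Fin n, S i j ≠ 0 ↔ ptDeg (D j) ≤ i) {r : Fin n} (hr : r ∈ blockStarts D) :
    aboveDiagCount D S r = labelSum n (runStart e) e r := by
  classical
  have hrow : ∀ i ∈ block D r,
      ((block D r).filter fun j => i < j ∧ S i j ≠ 0).card = e i := by
    intro i hi
    have h1 : ((block D r).filter fun j => i < j ∧ S i j ≠ 0) =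
        below n (i + 1 + e i) \ below n (i + 1) := by
      ext j
      rw [Finset.mem_filter, hS, ptDeg_le_iff hD, he _ i.isLt, Finset.mem_sdiff, mem_below,
        mem_below, Fin.lt_def]
      refine ⟨fun h => by omega, fun h => ⟨?_, by omega⟩⟩
      rw [mem_block_iff hD he hr] at hi ⊢
      rw [runStart_eq_iff] at hi ⊢
      obtain ⟨h2, h3, h4⟩ := hi
      refine ⟨h2, by omega, fun l hl hlj => ?_⟩
      rcases Nat.lt_or_ge l i with h5 | h5
      · exact h4 l hl h5
      · have h6 := (ptDeg_le_iff hD j i).2 (by rw [he _ i.isLt]; exact h.1)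
        have h7 := (ptDeg_le_iff hD j l).1 (by omega)
        rw [he _ (by omega)] at h7
        omega
    have h2 := levelCount_le D i
    rw [he _ i.isLt] at h2
    rw [h1, Finset.card_sdiff_of_subset, card_below h2, card_below (by omega)]
    · omega
    · intro j hj
      rw [mem_below] at hj ⊢
      omega
  have h1 : aboveDiagCount D S r =
      ∑ i ∈ block D r, ((block D r).filter fun j => i < j ∧ S i j ≠ 0).card := by
    simp only [aboveDiagCount, Finset.card_filter, Finset.sum_product]
  rw [h1, Finset.sum_congr rfl hrow, labelSum, Finset.sum_range, ← Finset.sum_filter]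
  refine Finset.sum_congr ?_ fun _ _ => rfl
  ext i
  simp [mem_block_iff hD he hr]

theorem card_blocks_eq_count {D : Fin n → ℕ × ℕ} {S : Matrix (Fin n) (Fin n) (CoordRing n)}
    (hD : Monotone fun j => ptDeg (D j)) {e : ℕ → ℕ} (he : HasProfile D e)
    (hS : ∀ i j : Fin n, S i j ≠ 0 ↔ ptDeg (D j) ≤ i) {m : ℕ} (hm : 0 < m) :
    ((blockStarts D).filter fun r => aboveDiagCount D S r = m).card =
      (labelType n (runStart e) e).count m := by
  rw [count_labelType _ _ hm, ← Finset.card_map Fin.valEmbedding]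
  congr 1
  ext r
  simp only [Finset.mem_map, Finset.mem_filter, Fin.valEmbedding_apply, Finset.mem_range]
  constructor
  · rintro ⟨r, ⟨h1, h2⟩, rfl⟩
    exact ⟨r.isLt, by rw [← aboveDiagCount_eq hD he hS h1, h2]⟩
  · rintro ⟨h1, h2⟩
    have h3 : (⟨r, h1⟩ : Fin n) ∈ blockStarts D := by
      rw [mem_blockStarts_iff hD he]
      by_contra h4
      refine hm.ne (h2.symm.trans (Finset.sum_eq_zero fun i _ => if_neg fun h5 => ?_)).symm
      exact h4 (runStart_eq_iff.1 h5).1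
    exact ⟨⟨r, h1⟩, ⟨h3, by rw [aboveDiagCount_eq hD he hS h3, h2]⟩, rfl⟩

theorem IsStaircaseForm.ne_zero_iff {D : Fin n → ℕ × ℕ} {S : Matrix (Fin n) (Fin n) (CoordRing n)}
    (h : IsStaircaseForm D S) (i j : Fin n) : S i j ≠ 0 ↔ ptDeg (D j) ≤ i := by
  obtain ⟨c, hc⟩ := h.entries
  rw [hc]
  split_ifs with hij
  · simp; omega
  · simp only [not_lt.1 hij, iff_true]
    refine Finset.prod_ne_zero_iff.2 fun l hl => diff_ne_zero _ ?_
    rintro rfl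
    simp at hl
    omega

theorem levelCount_zero_le_one {D : Fin n → ℕ × ℕ} (hD : Function.Injective D) :
    levelCount D 0 ≤ 1 := by
  refine Finset.card_le_one.2 fun i hi j hj => hD ?_
  have h1 : (D i).1 + (D i).2 ≤ 0 := (Finset.mem_filter.1 hi).2
  have h2 : (D j).1 + (D j).2 ≤ 0 := (Finset.mem_filter.1 hj).2
  exact Prod.ext (by omega) (by omega)

theorem IsStaircaseForm.exists_profile {D : Fin n → ℕ × ℕ}
    {S : Matrix (Fin n) (Fin n) (CoordRing n)} (h : IsStaircaseForm D S) (hS : S.det ≠ 0) :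
    ∃ e, HasProfile D e ∧ ∀ i, n ≤ i + 1 → e i = 0 := by
  refine ⟨fun m => levelCount D m - (m + 1), fun m hm => ?_, fun i hi => ?_⟩
  · have : m < levelCount D m := by
      by_contra hle
      refine hS (det_eq_zero_of_levelCount_le (D := D) (fun i j hij => ?_) hm (not_lt.1 hle))
      by_contra h0
      have := (h.ne_zero_iff i j).1 h0
      omega
    beta_reduce
    omega
  · have := levelCount_le D i
    beta_reduce
    omega

/-! ### Minimal staircase forms -/

theorem stairMatrix_isStaircaseForm {D : Fin n → ℕ × ℕ} (hinj : Function.Injective D)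
    (hmono : Monotone fun j => ptDeg (D j)) (hD : ∀ j, ptDeg (D j) ≤ n) (ε : Bool) :
    IsStaircaseForm D (stairMatrix D ε) where
  injective := hinj
  monotone := hmono
  entries := by
    refine ⟨fun _ j => coloring n (D j) ε, fun i j => ?_⟩
    split_ifs with h
    · exact diffMatrix_apply_eq_zero _ (mem_below.2 h)
    · rfl
  det_equiv := stairMatrix_det_sub_Delta_mem hD ε

theorem labelType_pos {M e : ℕ → ℕ} {m : ℕ} (hm : m ∈ labelType n M e) : 0 < m :=
  (Multiset.mem_filter.1 hm).2

/-- The uniformly coloured staircase form of a tuple whose profile has no value larger than one is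
minimal. -/
theorem containsProfile_of_le_one {k d₁ d₂ : ℕ} {μ : k.Partition} {e : ℕ → ℕ}
    (he : IsAdmissible n k e) (hP : Refines n e μ.parts) (hle : ∀ i, e i ≤ 1) :
    ContainsProfile (diagIdealLT n (d₁ + d₂) ⊔ Ideal.span (minimalForms n d₁ d₂ μ)) (d₁, d₂) e := by
  intro D hbi hD
  by_cases hinj : Function.Injective D
  swap
  · simp only [Function.Injective, not_forall] at hinj
    obtain ⟨i, j, hij, hne⟩ := hinj
    rw [Delta_eq_zero_of_eq D hne hij]
    exact Ideal.zero_mem _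
  set σ := Tuple.sort fun j => ptDeg (D j) with hσ
  set D' := D ∘ σ with hD'
  have hmono : Monotone fun j => ptDeg (D' j) := Tuple.monotone_sort fun j => ptDeg (D j)
  have hbi' : bidegree D' = (d₁, d₂) := by
    rw [← hbi, bidegree_eq_sum, bidegree_eq_sum]
    exact Equiv.sum_comp σ D
  have hprof : HasProfile D' e := fun m hm => by
    rw [← hD m hm]
    simp only [levelCount, Finset.card_filter]
    exact Equiv.sum_comp σ fun j => if ptDeg (D j) ≤ m then 1 else 0
  have hdeg : degree D' = d₁ + d₂ := by rw [degree_eq, hbi']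
  have hform := stairMatrix_isStaircaseForm (hinj.comp σ.injective) hmono
    (fun j => (hprof.ptDeg_lt j).le) true
  have hdet : (stairMatrix D' true).det ∈
      diagIdealLT n (d₁ + d₂) ⊔ Ideal.span (minimalForms n d₁ d₂ μ) := by
    -- a minimal staircase form has to be nonzero, but a vanishing determinant does no harm
    by_cases h0 : (stairMatrix D' true).det = 0
    · rw [h0]; exact Ideal.zero_mem _
    refine Ideal.mem_sup_right (Ideal.subset_span ?_)
    obtain ⟨G, hG1, hG2⟩ := hP.exists_groups
    have hsum : (labelType n (runStart e) e).sum = k := by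
      rw [sum_labelType fun i hi => runStart_lt hi, he.sum]
    let ν : k.Partition := ⟨labelType n (runStart e) e, labelType_pos, hsum⟩
    refine ⟨D', stairMatrix D' true, ν, hbi', ⟨⟨hform, h0, fun m hm => ?_⟩, fun i j hij => ?_⟩,
      ?_, rfl⟩
    · exact (card_blocks_eq_count hmono hprof hform.ne_zero_iff hm).symm
    · by_contra h1
      have h2 := (ptDeg_le_iff hmono j i).1 ((hform.ne_zero_iff i j).1 h1)
      rw [hprof _ i.isLt] at h2
      have := hle i
      omega
    · by_cases h1 : ν = μ
      · exact .inl h1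
      · exact .inr ⟨h1, G, hG1, hG2⟩
  have h1 := Ideal.sub_mem _ hdet (Ideal.mem_sup_left (hdeg ▸ hform.det_equiv))
  rw [sub_sub_cancel, Delta_comp_perm] at h1
  rcases Int.units_eq_one_or (Equiv.Perm.sign σ) with hs | hs
  · simpa [hs] using h1
  · simpa [hs] using h1

theorem containsProfile_of_refines {k d₁ d₂ : ℕ} (hn : 4 * k + 4 ≤ n) {μ : k.Partition}
    {e : ℕ → ℕ} (he : IsAdmissible n k e) (hP : Refines n e μ.parts) :
    ContainsProfile (diagIdealLT n (d₁ + d₂) ⊔ Ideal.span (minimalForms n d₁ d₂ μ))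
      (d₁, d₂) e := by
  have hK : diagIdealLT n (((d₁, d₂) : ℕ × ℕ).1 + ((d₁, d₂) : ℕ × ℕ).2) ≤
      diagIdealLT n (d₁ + d₂) ⊔ Ideal.span (minimalForms n d₁ d₂ μ) := le_sup_left
  exact ContainsProfile.reduce_right hK hn (ContainsProfile.reduce_left hK hn
    fun _ he hP hle => containsProfile_of_le_one he hP hle) e he hP

end DiagonalIdeal

open DiagonalIdeal in
theorem proposition2p8 (n k d₁ d₂ : ℕ) (hn : 8 * k + 5 ≤ n)
    (hd₁ : (2 * k + 1) * n ≤ d₁) (hd₂ : (2 * k + 1) * n ≤ d₂) (μ : k.Partition)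
    (D : Fin n → ℕ × ℕ) (S : Matrix (Fin n) (Fin n) (DiagonalIdeal.CoordRing n))
    (hD : DiagonalIdeal.bidegree D = (d₁, d₂))
    (hS : DiagonalIdeal.HasPartitionType D S μ) :
    S.det ∈ DiagonalIdeal.diagIdealLT n (d₁ + d₂) ⊔
      Ideal.span (DiagonalIdeal.minimalForms n d₁ d₂ μ) := by
  have hform := hS.isStaircaseForm
  have hmono := hform.monotone
  obtain ⟨e, hprof, hlast⟩ := hform.exists_profile hS.det_ne_zero
  have htype : labelType n (runStart e) e = μ.parts := by
    ext m
    rcases Nat.eq_zero_or_pos m with rfl | hm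
    · rw [Multiset.count_eq_zero_of_notMem fun h => (labelType_pos h).false,
        Multiset.count_eq_zero_of_notMem fun h => (μ.parts_pos h).false]
    · rw [hS.count_parts m hm, card_blocks_eq_count hmono hprof hform.ne_zero_iff hm]
  have hrun : ∀ i, 0 < e i → 0 < e (i + 1) → runStart e i = runStart e (i + 1) := by
    intro i hi _
    obtain ⟨h1, h2, h3⟩ := runStart_eq_iff.1 (rfl : runStart e i = _)
    refine (runStart_eq_iff.2 ⟨h1, by omega, fun l hl1 hl2 => ?_⟩).symm
    rcases (Nat.lt_succ_iff.1 hl2).eq_or_lt with rfl | h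
    · exact hi
    · exact h3 l hl1 h
  have hadm : IsAdmissible n k e := by
    refine ⟨?_, fun i hi => ?_, ?_⟩
    · have h1 := hprof 0 (by omega)
      have h2 := levelCount_zero_le_one hform.injective
      omega
    · exact hlast i hi
    · rw [← sum_labelType fun i hi => runStart_lt hi, htype, μ.parts_sum]
  have href : Refines n e μ.parts := ⟨runStart e, hrun, fun i hi => runStart_lt hi, htype⟩
  have hmem := containsProfile_of_refines (d₁ := d₁) (d₂ := d₂) (by omega) hadm href D hD hprof
  have hdeg : degree D = d₁ + d₂ := by rw [degree_eq, hD]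
  have h1 := hform.det_equiv
  rw [hdeg] at h1
  have h2 := Ideal.add_mem _ (Ideal.mem_sup_left h1) hmem
  rwa [sub_add_cancel] at h2
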